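/- **Conventions.** Let $X$ be a topological space. A real analytic *orbifold chart* $(\tilde U,G,\varphi)$ of dimension $n$ on $X$ consists of a (nonempty) connected open set $\tilde U\subset\mathbb R^n$, a finite group $G$ acting real analytically on $\tilde U$, and a $G$-invariant map $\varphi\colon\tilde U\to X$ inducing a homeomorphism of $\tilde U/G$ onto an open subset of $X$; $\ker(G)\subset G$ is the subgroup acting trivially. An *embedding* $(\tilde U,G,\varphi)\to(\tilde V,H,\psi)$ is a pair $(\lambda,\theta)$ of an injective homomorphism $\theta\colon G\to H$ restricting to an isomorphism $\ker(G)\to\ker(H)$, and a $\theta$-equivariant real analytic embedding $\lambda\colon\tilde U\to\tilde V$ with $\psi\circ\lambda=\varphi$. An *atlas* is a family of charts covering $X$ such that for any two charts of the family and any $x$ in the intersection of their images there is a chart of the family whose image contains $x$ and which embeds into both. An atlas *refines* another one if each of its charts embeds into some chart of the other; two atlases are *equivalent* if they have a common refinement. A real analytic $n$-dimensional *orbifold* is a paracompact Hausdorff space with an equivalence class of atlases, or equivalently with the maximal atlas of the class. It is *reduced* if $G$ acts effectively on $\tilde U$ for every chart $(\tilde U,G,\varphi)$ of the maximal atlas.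 A map $f\colon X\to Y$ of orbifolds is a *real analytic orbifold map* if for every $x\in X$ there are charts $(\tilde U,G,\varphi)$ around $x$ and $(\tilde V,H,\psi)$ around $f(x)$ such that $f(\varphi(\tilde U))\subset\psi(\tilde V)$ and $f|_{\varphi(\tilde U)}$ lifts to a real analytic map $\tilde U\to\tilde V$ that is equivariant with respect to some homomorphism $G\to H$; it is a *real analytic diffeomorphism* if it is bijective and $f$ and $f^{-1}$ are real analytic orbifold maps. Let $\{(\tilde U_i,G_i,\varphi_i)\}_{i\in I}$ be the maximal atlas of a real analytic $n$-dimensional orbifold $X$. The group $G_i$ acts on $\mathrm{Fr}(\tilde U_i)=\tilde U_i\times \mathrm{GL}_n(\mathbb R)$ by $g(x,B)=(gx,(dg)_x\circ B)$. Every embedding $\lambda$ from the $i$-th to the $j$-th chart induces $\lambda_*\colon \mathrm{Fr}(\tilde U_i)/G_i\to \mathrm{Fr}(\tilde U_j)/G_j$, $[x,B]\mapsto[\lambda(x),(d\lambda)_x\circ B]$. The *frame bundle* of $X$ is the colimit $\mathrm{Fr}(X)=\varinjlim\{\mathrm{Fr}(\tilde U_i)/G_i,\lambda_*\}$ over all embeddings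 between charts of the maximal atlas, with the colimit topology. The right action $[x,B]\cdot A=[x,B\circ A]$, regarded as the left action $A\,[x,B]=[x,B\circ A^{-1}]$, defines an action of $\mathrm{GL}_n(\mathbb R)$ on $\mathrm{Fr}(X)$, and $[x,B]\mapsto\varphi_i(x)$ defines $p\colon\mathrm{Fr}(X)\to X$. For an action of a Lie group $H$ on a real analytic manifold $M$, a *linear slice* at $x\in M$ is an $H_x$-invariant real analytic submanifold $N_x\ni x$ which is $H_x$-equivariantly analytically diffeomorphic to a linear representation space of the isotropy group $H_x$, with $x$ corresponding to $0$, such that $H\times_{H_x}N_x\to M$, $[a,y]\mapsto ay$, is a real analytic diffeomorphism onto an open subset. The *quotient orbifold* $M/H$ is the orbit space with the orbifold structure given by the charts $(N_x,H_x,\pi_x)$, where $\pi_x\colon N_x\to N_x/H_x\cong HN_x/H$. **Theorem.** Let $X$ be a nonempty reduced real analytic orbifold of dimension $n$, and let $\mathrm{Fr}(X)$ be its frame bundle. Then: 1. $\mathrm{Fr}(X)$ is a (paracompact Hausdorff) real analytic manifold: each canonical map $\mathrm{Fr}(\tilde U_i)/G_i\to\mathrm{Fr}(X)$ is an open topological embedding,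 and there is a real analytic structure on $\mathrm{Fr}(X)$ for which all the maps $\mathrm{Fr}(\tilde U_i)\to\mathrm{Fr}(X)$ are real analytic local diffeomorphisms. 2. With respect to this structure, the action of $\mathrm{GL}_n(\mathbb R)$ on $\mathrm{Fr}(X)$ is proper, effective, almost free (all isotropy groups are finite) and real analytic. 3. The linear slices of this action define a reduced quotient orbifold $\mathrm{Fr}(X)/\mathrm{GL}_n(\mathbb R)$, and it is real analytically diffeomorphic to $X$, by the map induced by $p$. -/

import Mathlib

open scoped Manifold ContDiff
open TopologicalSpace (Opens)

namespace FrameOrbifold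

/-! ### Euclidean space, the general linear group, derivatives and frames -/

/-- The Euclidean space `ℝⁿ`. -/
abbrev Euc (n : ℕ) : Type := EuclideanSpace ℝ (Fin n)

/-- The algebra of linear endomorphisms of `ℝⁿ`. -/
abbrev EndEuc (n : ℕ) : Type := Euc n →L[ℝ] Euc n

/-- The Lie group `GL_n(ℝ)` of invertible linear endomorphisms of `ℝⁿ`. -/
abbrev GLn (n : ℕ) : Type := (EndEuc n)ˣ

/-- The model with corners (without boundary) for `n`-dimensional manifolds. -/
noncomputable abbrev modelEuc (n : ℕ) : ModelWithCorners ℝ (Euc n) (Euc n) := 𝓘(ℝ, Euc n)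

/-- The model with corners of the Lie group `GL_n(ℝ)`. -/
noncomputable abbrev modelGL (n : ℕ) : ModelWithCorners ℝ (EndEuc n) (EndEuc n) :=
  𝓘(ℝ, EndEuc n)

/-- The space on which frame bundles of `n`-dimensional objects are modelled. -/
abbrev FrameModelSpace (n : ℕ) : Type := ModelProd (Euc n) (EndEuc n)

/-- The model with corners (without boundary) for frame bundles of `n`-dimensional objects. -/
noncomputable abbrev modelFrame (n : ℕ) :
    ModelWithCorners ℝ (Euc n × EndEuc n) (FrameModelSpace n) :=
  (modelEuc n).prod (modelGL n)

/-- The derivative `(df)_x` of a map between open subsets of `ℝⁿ`, an endomorphism of `ℝⁿ`. -/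
noncomputable def jac {n : ℕ} {U V : Opens (Euc n)} (f : U → V) (x : U) : EndEuc n :=
  mfderiv (modelEuc n) (modelEuc n) f x

/-- A map between open subsets of `ℝⁿ` is real analytic. -/
def IsAnalyticMap {n : ℕ} {U V : Opens (Euc n)} (f : U → V) : Prop :=
  ContMDiff (modelEuc n) (modelEuc n) ω f

theorem IsAnalyticMap.mdifferentiable {n : ℕ} {U V : Opens (Euc n)} {f : U → V}
    (hf : IsAnalyticMap f) : MDifferentiable (modelEuc n) (modelEuc n) f :=
  ContMDiff.mdifferentiable hf (by simp)

theorem jac_id {n : ℕ} {U : Opens (Euc n)} (x : U) : jac (fun y : U => y) x = 1 := by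
  have h := mfderiv_id (I := modelEuc n) (x := x)
  exact h

theorem jac_comp {n : ℕ} {U V W : Opens (Euc n)} {g : V → W} {f : U → V}
    (hg : IsAnalyticMap g) (hf : IsAnalyticMap f) (x : U) :
    jac (fun y => g (f y)) x = jac g (f x) * jac f x :=
  mfderiv_comp x (hg.mdifferentiable (f x)) (hf.mdifferentiable x)

/-- The frame bundle `Fr(U) = U × GL_n(ℝ)` of an open subset `U` of `ℝⁿ`: the pair `(x, B)` is the
frame `B : ℝⁿ → T_x U = ℝⁿ` at the point `x`. -/
abbrev Frame {n : ℕ} (U : Opens (Euc n)) : Type := U × GLn n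

/-- The map `(f, df) : Fr(U) → Fr(V)`, `(x, B) ↦ (f x, (df)_x ∘ B)`, induced by a map `f : U → V`
with invertible derivatives. -/
noncomputable def frameMap {n : ℕ} {U V : Opens (Euc n)} (f : U → V)
    (hf : ∀ x, IsUnit (jac f x)) (z : Frame U) : Frame V :=
  (f z.1, (hf z.1).unit * z.2)

/-! ### Real analytic orbifold charts and their embeddings -/

/-- A real analytic orbifold chart `(Ũ, G, φ)` of dimension `n` on `X`: a connected open subset `Ũ`
of `ℝⁿ`, a finite group `G` acting real analytically on `Ũ`, and a `G`-invariant map `φ : Ũ → X`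
that induces a homeomorphism of `Ũ / G` onto an open subset of `X`. -/
structure OrbifoldChart (n : ℕ) (X : Type*) [TopologicalSpace X] where
  /-- The domain `Ũ` of the chart. -/
  dom : Opens (Euc n)
  isConnected_dom : IsConnected (dom : Set (Euc n))
  /-- The finite group of the chart. -/
  G : Type
  [group : Group G]
  [finite : Finite G]
  [action : MulAction G dom]
  analytic_smul : ∀ g : G, IsAnalyticMap (fun x : dom => g • x)
  /-- The projection of the chart. -/
  proj : dom → X
  proj_smul : ∀ (g : G) (x : dom), proj (g • x) = proj x
  isOpenEmbedding_lift : Topology.IsOpenEmbedding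
    (Quotient.lift proj (by rintro a b ⟨g, rfl⟩; exact proj_smul g b) :
      MulAction.orbitRel.Quotient G dom → X)

attribute [instance] OrbifoldChart.group OrbifoldChart.finite OrbifoldChart.action

/-- The subgroup `ker(G)` of `G` acting trivially on `Ũ`. -/
def OrbifoldChart.ker {n : ℕ} {X : Type*} [TopologicalSpace X] (c : OrbifoldChart n X) :
    Subgroup c.G :=
  (MulAction.toPermHom c.G c.dom).ker

/-- A real analytic embedding `(λ, θ)` between two orbifold charts: an injective homomorphism
`θ : G → H` restricting to an isomorphism `ker(G) → ker(H)`, and a `θ`-equivariant real analytic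
embedding `λ` (a topological embedding which is real analytic and immersive) over `X`. -/
structure ChartEmbedding {n : ℕ} {X : Type*} [TopologicalSpace X]
    (c d : OrbifoldChart n X) where
  /-- The homomorphism `θ`. -/
  hom : c.G →* d.G
  hom_injective : Function.Injective hom
  map_ker : c.ker.map hom = d.ker
  /-- The map `λ`. -/
  map : c.dom → d.dom
  isEmbedding : Topology.IsEmbedding map
  analytic : IsAnalyticMap map
  immersive : ∀ x, Function.Injective (jac map x)
  equivariant : ∀ (g : c.G) (x : c.dom), map (g • x) = hom g • map x
  proj_map : ∀ x : c.dom, d.proj (map x) = c.proj x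

/-! ### Real analytic orbifolds -/

/-- A family of real analytic orbifold charts is an orbifold atlas: it covers `X`, and any two
charts of the family are locally linked by a chart of the family embedding into both. -/
structure IsOrbifoldAtlas {n : ℕ} {X : Type*} [TopologicalSpace X]
    (A : Set (OrbifoldChart n X)) : Prop where
  cover : ∀ x : X, ∃ c ∈ A, x ∈ Set.range c.proj
  compat : ∀ c ∈ A, ∀ d ∈ A, ∀ x ∈ Set.range c.proj ∩ Set.range d.proj,
    ∃ e ∈ A, x ∈ Set.range e.proj ∧
      Nonempty (ChartEmbedding e c) ∧ Nonempty (ChartEmbedding e d)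

/-- `A` refines `B` if every chart in `A` admits an embedding into some chart in `B`. -/
def Refines {n : ℕ} {X : Type*} [TopologicalSpace X] (A B : Set (OrbifoldChart n X)) : Prop :=
  ∀ c ∈ A, ∃ d ∈ B, Nonempty (ChartEmbedding c d)

/-- Two atlases are equivalent if they have a common refinement. -/
def AtlasEquiv {n : ℕ} {X : Type*} [TopologicalSpace X] (A B : Set (OrbifoldChart n X)) : Prop :=
  ∃ C : Set (OrbifoldChart n X), IsOrbifoldAtlas C ∧ Refines C A ∧ Refines C B

/-- An `n`-dimensional real analytic orbifold structure on a topological space `X`: the space is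
paracompact Hausdorff, and it is equipped with an equivalence class of real analytic orbifold
atlases, represented by the maximal atlas in the class. -/
structure AnalyticOrbifold (n : ℕ) (X : Type*) [TopologicalSpace X] where
  t2Space : T2Space X
  paracompactSpace : ParacompactSpace X
  /-- The maximal atlas. -/
  atlas : Set (OrbifoldChart n X)
  isAtlas : IsOrbifoldAtlas atlas
  maximal : ∀ A : Set (OrbifoldChart n X), IsOrbifoldAtlas A → AtlasEquiv A atlas → A ⊆ atlas

/-- An orbifold is reduced if the group of every chart acts effectively. -/
def AnalyticOrbifold.IsReduced {n : ℕ} {X : Type*} [TopologicalSpace X]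
    (O : AnalyticOrbifold n X) : Prop :=
  ∀ c ∈ O.atlas, FaithfulSMul c.G c.dom

/-- Real analytic orbifold maps: locally, they lift to real analytic equivariant maps between
orbifold charts. -/
def IsAnalyticOrbifoldMap {n m : ℕ} {X Y : Type*} [TopologicalSpace X] [TopologicalSpace Y]
    (O : AnalyticOrbifold n X) (P : AnalyticOrbifold m Y) (f : X → Y) : Prop :=
  ∀ x : X, ∃ c ∈ O.atlas, ∃ d ∈ P.atlas, x ∈ Set.range c.proj ∧ f x ∈ Set.range d.proj ∧
    Set.MapsTo f (Set.range c.proj) (Set.range d.proj) ∧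
    ∃ (F : c.dom → d.dom) (θ : c.G →* d.G),
      ContMDiff (modelEuc n) (modelEuc m) ω F ∧
      (∀ (g : c.G) (u : c.dom), F (g • u) = θ g • F u) ∧
      ∀ u : c.dom, d.proj (F u) = f (c.proj u)

/-- Real analytic diffeomorphisms of orbifolds: bijections that are real analytic orbifold maps in
both directions. -/
def IsAnalyticOrbifoldDiffeo {n m : ℕ} {X Y : Type*} [TopologicalSpace X] [TopologicalSpace Y]
    (O : AnalyticOrbifold n X) (P : AnalyticOrbifold m Y) (f : X ≃ Y) : Prop :=
  IsAnalyticOrbifoldMap O P f ∧ IsAnalyticOrbifoldMap P O f.symm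

/-! ### Quotient orbifolds -/

/-- The orbifold charts `(N_x, H_x, π_x)` of an orbit space `M / H`, where `H` is a Lie group acting
on a manifold `M`, `H_x` is the isotropy group of `x` and `N_x` is a linear slice at `x`.
The slice is parametrized by a real analytic map `s : ℝⁿ → M` with `s 0 = x`, equivariant for an
isomorphism `ι : G ≃ H_x` from the group `G` of the chart, where `G` acts linearly on `ℝⁿ`; that
`N_x = s(ℝⁿ)` is a slice means that `H ×_{H_x} N_x → M`, `[a, y] ↦ a • y`, is a real
analytic diffeomorphism onto an open subset of `M`. -/
def IsLinearSliceChart {n : ℕ} {E' H' H E'' H'' M : Type*}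
    [NormedAddCommGroup E'] [NormedSpace ℝ E'] [TopologicalSpace H']
    (I' : ModelWithCorners ℝ E' H') [TopologicalSpace H] [ChartedSpace H' H] [Group H]
    [NormedAddCommGroup E''] [NormedSpace ℝ E''] [TopologicalSpace H'']
    (I'' : ModelWithCorners ℝ E'' H'') [TopologicalSpace M] [ChartedSpace H'' M] [MulAction H M]
    (c : OrbifoldChart n (MulAction.orbitRel.Quotient H M)) : Prop :=
  c.dom = ⊤ ∧
  (∀ g : c.G, ∃ L : EndEuc n, ∀ u : c.dom, ((g • u : c.dom) : Euc n) = L u) ∧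
  ∃ (o : c.dom) (s : c.dom → M) (ι : c.G ≃* MulAction.stabilizer H (s o)),
    (o : Euc n) = 0 ∧
    ContMDiff (modelEuc n) I'' ω s ∧
    (∀ (g : c.G) (u : c.dom), s (g • u) = (ι g : H) • s u) ∧
    (∀ u : c.dom, c.proj u = Quotient.mk (MulAction.orbitRel H M) (s u)) ∧
    IsLocalDiffeomorph (I'.prod (modelEuc n)) I'' ω (fun p : H × c.dom => p.1 • s p.2) ∧
    (∀ (a b : H) (u v : c.dom), a • s u = b • s v →
      ∃ g : c.G, b = a * (ι g : H)⁻¹ ∧ v = g • u)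

/-- `Q` is the quotient orbifold structure on the orbit space `M / H`, i.e. the one whose charts are
given by the linear slices: these form an orbifold atlas, contained in the maximal atlas of `Q`. -/
def IsQuotientOrbifold {n : ℕ} {E' H' H E'' H'' M : Type*}
    [NormedAddCommGroup E'] [NormedSpace ℝ E'] [TopologicalSpace H']
    (I' : ModelWithCorners ℝ E' H') [TopologicalSpace H] [ChartedSpace H' H] [Group H]
    [NormedAddCommGroup E''] [NormedSpace ℝ E''] [TopologicalSpace H'']
    (I'' : ModelWithCorners ℝ E'' H'') [TopologicalSpace M] [ChartedSpace H'' M] [MulAction H M]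
    (Q : AnalyticOrbifold n (MulAction.orbitRel.Quotient H M)) : Prop :=
  IsOrbifoldAtlas {c : OrbifoldChart n (MulAction.orbitRel.Quotient H M) |
    IsLinearSliceChart I' I'' c} ∧
  {c : OrbifoldChart n (MulAction.orbitRel.Quotient H M) | IsLinearSliceChart I' I'' c} ⊆ Q.atlas

/-! ### The frame bundle of a chart -/

section Chart

variable {n : ℕ} {X : Type*} [TopologicalSpace X]

theorem OrbifoldChart.isUnit_jac_smul (c : OrbifoldChart n X) (g : c.G) (x : c.dom) :
    IsUnit (jac (fun y : c.dom => g • y) x) := by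
  have key : ∀ (h : c.G) (y : c.dom),
      jac (fun z : c.dom => h⁻¹ • z) (h • y) * jac (fun z : c.dom => h • z) y = 1 := by
    intro h y
    rw [← jac_comp (c.analytic_smul h⁻¹) (c.analytic_smul h) y]
    simp only [inv_smul_smul]
    exact jac_id y
  have h1 := key g x
  have h2 := key g⁻¹ (g • x)
  rw [inv_smul_smul, inv_inv] at h2
  exact ⟨⟨_, _, h2, h1⟩, rfl⟩

theorem ChartEmbedding.isUnit_jac {c d : OrbifoldChart n X} (e : ChartEmbedding c d)
    (x : c.dom) : IsUnit (jac e.map x) :=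
  ContinuousLinearMap.isUnit_iff_bijective.2 ⟨e.immersive x,
    (LinearMap.injective_iff_surjective (f := (jac e.map x).toLinearMap)).1 (e.immersive x)⟩

/-- The action of the group `G` of a chart on the frame bundle `Fr(Ũ)` of its domain,
`g (x, B) = (g x, (dg)_x ∘ B)`. -/
noncomputable instance OrbifoldChart.frameAction (c : OrbifoldChart n X) :
    MulAction c.G (Frame c.dom) where
  smul g z := frameMap (fun y : c.dom => g • y) (c.isUnit_jac_smul g) z
  one_smul z := by
    refine Prod.ext (one_smul _ _) (Units.ext ?_)
    change jac (fun y : c.dom => (1 : c.G) • y) z.1 * (z.2 : EndEuc n) = z.2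
    simp only [one_smul, jac_id, one_mul]
  mul_smul g h z := by
    refine Prod.ext (mul_smul _ _ _) (Units.ext ?_)
    change jac (fun y : c.dom => (g * h) • y) z.1 * (z.2 : EndEuc n) =
      jac (fun y : c.dom => g • y) (h • z.1) *
        (jac (fun y : c.dom => h • y) z.1 * (z.2 : EndEuc n))
    rw [← mul_assoc, ← jac_comp (c.analytic_smul g) (c.analytic_smul h)]
    simp only [mul_smul]

theorem OrbifoldChart.frame_smul_def (c : OrbifoldChart n X) (g : c.G) (z : Frame c.dom) :
    g • z = frameMap (fun y : c.dom => g • y) (c.isUnit_jac_smul g) z := rfl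

/-- The quotient `Fr(Ũ) / G`. -/
abbrev OrbifoldChart.FrameQuotient (c : OrbifoldChart n X) : Type :=
  MulAction.orbitRel.Quotient c.G (Frame c.dom)

/-- The class in `Fr(Ũ) / G` of a frame on `Ũ`. -/
noncomputable def OrbifoldChart.frameClass (c : OrbifoldChart n X) (z : Frame c.dom) : c.FrameQuotient :=
  Quotient.mk (MulAction.orbitRel c.G (Frame c.dom)) z

theorem OrbifoldChart.frameClass_smul (c : OrbifoldChart n X) (g : c.G) (z : Frame c.dom) :
    c.frameClass (g • z) = c.frameClass z :=
  Quotient.sound (s := MulAction.orbitRel c.G (Frame c.dom)) ⟨g, rfl⟩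

/-- The action of `A ∈ GL_n(ℝ)` on frames, `(x, B) ↦ (x, B ∘ A⁻¹)`: this is the right action
`(x, B) A = (x, B ∘ A)` turned into a left action. -/
noncomputable def frameMulInv {U : Opens (Euc n)} (A : GLn n) (z : Frame U) : Frame U :=
  (z.1, z.2 * A⁻¹)

theorem OrbifoldChart.frameMulInv_smul (c : OrbifoldChart n X) (A : GLn n) (g : c.G)
    (z : Frame c.dom) : frameMulInv A (g • z) = g • frameMulInv A z :=
  Prod.ext rfl (mul_assoc _ _ _)

/-- The action of `GL_n(ℝ)` on `Fr(Ũ) / G`, `A [x, B] = [x, B ∘ A⁻¹]`. -/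
noncomputable instance OrbifoldChart.glAction (c : OrbifoldChart n X) :
    MulAction (GLn n) c.FrameQuotient where
  smul A := Quotient.lift (fun z => c.frameClass (frameMulInv A z)) (by
    rintro _ b ⟨g, rfl⟩
    change c.frameClass (frameMulInv A (g • b)) = _
    rw [c.frameMulInv_smul, c.frameClass_smul])
  one_smul q := by
    induction q using Quotient.inductionOn with
    | h z =>
      change c.frameClass (frameMulInv 1 z) = c.frameClass z
      exact congrArg c.frameClass (Prod.ext rfl (by simp [frameMulInv]))
  mul_smul A B q := by
    induction q using Quotient.inductionOn with
    | h z =>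
      change c.frameClass (frameMulInv (A * B) z) =
        c.frameClass (frameMulInv A (frameMulInv B z))
      exact congrArg c.frameClass (Prod.ext rfl (by simp [frameMulInv, mul_assoc]))

theorem OrbifoldChart.gl_smul_frameClass (c : OrbifoldChart n X) (A : GLn n) (z : Frame c.dom) :
    A • c.frameClass z = c.frameClass (frameMulInv A z) := rfl

/-- The map `Fr(Ũ) / G → X` induced by the projection of the chart. -/
noncomputable def OrbifoldChart.frameProj (c : OrbifoldChart n X) : c.FrameQuotient → X :=
  Quotient.lift (fun z => c.proj z.1) (by rintro _ b ⟨g, rfl⟩; exact c.proj_smul g b.1)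

/-- The map `(λ, dλ) : Fr(Ũ) → Fr(Ṽ)` induced by an embedding of charts. -/
noncomputable def ChartEmbedding.frameMap {c d : OrbifoldChart n X} (e : ChartEmbedding c d) :
    Frame c.dom → Frame d.dom :=
  FrameOrbifold.frameMap e.map e.isUnit_jac

theorem ChartEmbedding.frameMap_smul {c d : OrbifoldChart n X} (e : ChartEmbedding c d)
    (g : c.G) (z : Frame c.dom) : e.frameMap (g • z) = e.hom g • e.frameMap z := by
  refine Prod.ext (e.equivariant g z.1) (Units.ext ?_)
  change jac e.map (g • z.1) * (jac (fun y : c.dom => g • y) z.1 * (z.2 : EndEuc n)) =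
    jac (fun y : d.dom => e.hom g • y) (e.map z.1) * (jac e.map z.1 * (z.2 : EndEuc n))
  rw [← mul_assoc, ← mul_assoc, ← jac_comp e.analytic (c.analytic_smul g),
    ← jac_comp (d.analytic_smul (e.hom g)) e.analytic]
  simp only [e.equivariant]

/-- The map `λ_* : Fr(Ũ) / G → Fr(Ṽ) / H` induced by an embedding of charts. -/
noncomputable def ChartEmbedding.frameQuotientMap {c d : OrbifoldChart n X}
    (e : ChartEmbedding c d) : c.FrameQuotient → d.FrameQuotient :=
  Quotient.lift (fun z => d.frameClass (e.frameMap z)) (by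
    rintro _ b ⟨g, rfl⟩
    change d.frameClass (e.frameMap (g • b)) = _
    rw [e.frameMap_smul, d.frameClass_smul])

theorem ChartEmbedding.frameQuotientMap_gl_smul {c d : OrbifoldChart n X}
    (e : ChartEmbedding c d) (A : GLn n) (q : c.FrameQuotient) :
    e.frameQuotientMap (A • q) = A • e.frameQuotientMap q := by
  induction q using Quotient.inductionOn with
  | h z =>
    change d.frameClass (e.frameMap (frameMulInv A z)) =
      d.frameClass (frameMulInv A (e.frameMap z))
    exact congrArg d.frameClass (Prod.ext rfl (mul_assoc _ _ _).symm)

theorem ChartEmbedding.frameProj_frameQuotientMap {c d : OrbifoldChart n X}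
    (e : ChartEmbedding c d) (q : c.FrameQuotient) :
    d.frameProj (e.frameQuotientMap q) = c.frameProj q := by
  induction q using Quotient.inductionOn with
  | h z => exact e.proj_map z.1

end Chart

/-! ### The frame bundle of an orbifold -/

section FrameBundle

variable {n : ℕ} {X : Type*} [TopologicalSpace X]

/-- The identifications `q ∼ λ_* q` that define the colimit of the spaces `Fr(Ũ_i) / G_i`,
for all the embeddings `λ` between charts of the maximal atlas. -/
inductive AnalyticOrbifold.FrameRel (O : AnalyticOrbifold n X) :
    (Σ c : O.atlas, c.1.FrameQuotient) → (Σ c : O.atlas, c.1.FrameQuotient) → Prop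
  | glue (c d : O.atlas) (e : ChartEmbedding c.1 d.1) (q : c.1.FrameQuotient) :
      O.FrameRel ⟨c, q⟩ ⟨d, e.frameQuotientMap q⟩

/-- The frame bundle `Fr(X)`, the colimit of the spaces `Fr(Ũ_i) / G_i` along the maps `λ_*`. -/
def AnalyticOrbifold.FrameBundle (O : AnalyticOrbifold n X) :=
  Quot O.FrameRel

/-- The colimit topology on the frame bundle. -/
instance AnalyticOrbifold.instTopologicalSpaceFrameBundle (O : AnalyticOrbifold n X) :
    TopologicalSpace O.FrameBundle :=
  inferInstanceAs (TopologicalSpace (Quot O.FrameRel))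

/-- The canonical map `Fr(Ũ_i) / G_i → Fr(X)`. -/
noncomputable def AnalyticOrbifold.ofChart (O : AnalyticOrbifold n X) (c : O.atlas)
    (q : c.1.FrameQuotient) : O.FrameBundle :=
  Quot.mk O.FrameRel ⟨c, q⟩

/-- The action of `GL_n(ℝ)` on the frame bundle. -/
noncomputable instance AnalyticOrbifold.frameBundleAction (O : AnalyticOrbifold n X) :
    MulAction (GLn n) O.FrameBundle where
  smul A := Quot.lift (fun p => O.ofChart p.1 (A • p.2)) (by
    rintro _ _ ⟨c, d, e, q⟩
    change O.ofChart c (A • q) = O.ofChart d (A • e.frameQuotientMap q)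
    rw [← e.frameQuotientMap_gl_smul]
    exact Quot.sound (.glue c d e _))
  one_smul z := by
    induction z using Quot.ind with
    | mk p => exact congrArg (O.ofChart p.1) (one_smul (GLn n) p.2)
  mul_smul A B z := by
    induction z using Quot.ind with
    | mk p => exact congrArg (O.ofChart p.1) (mul_smul A B p.2)

/-- The projection `p : Fr(X) → X`. -/
noncomputable def AnalyticOrbifold.frameBundleProj (O : AnalyticOrbifold n X) : O.FrameBundle → X :=
  Quot.lift (fun p => p.1.1.frameProj p.2) (by
    rintro _ _ ⟨c, d, e, q⟩
    exact (e.frameProj_frameQuotientMap q).symm)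

end FrameBundle

end FrameOrbifold

open FrameOrbifold

namespace FrameOrbifold

open Set Filter Topology

/-! ### Shortcut instances -/

/-! Two facts drive the proof. The first is rigidity (`exists_eqOn_act`): two analytic lifts of the
same map to a connected open set differ by one fixed element of the chart group, by Baire and the
identity theorem. Hence a transition map, i.e. a germ of analytic local diffeomorphism between chart
domains over `X`, is unique up to the group of its target. It follows that frames in two charts
define the same point of the colimit exactly when some transition map carries one to the other
(`frame_liftFrame`, `exists_liftFrame_eq`), so each `Fr(Ũ)/G` embeds openly in `Fr(X)`.

The second fact is linearization. Averaging makes an isotropy group linear near its fixed point, so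
in a reduced chart an element fixing a point with derivative the identity is trivial. Therefore `G`
acts freely on `Fr(Ũ)` (`frame_smul_eq_self_iff`), the maps `Fr(Ũ) → Fr(X)` are local
homeomorphisms, and lifted transition maps are their analytic coordinate changes. Hausdorffness and
paracompactness are checked locally over `X`. Isotropy groups are finite because an isotropy element
is determined by an element of the finite chart group; the same finiteness, applied along an
ultrafilter, gives properness. The action is effective because reduced charts have points with
trivial isotropy.

The fibres of `p` are the `GL_n(ℝ)`-orbits and `p` is open, so the orbit space is homeomorphic to
`X`, and the orbifold structure of `X` is transported to it. It remains to see that this is the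
slice structure. A linear chart yields the slice `u ↦ [u, 1]` (`isLinearSliceChart_of_isLinear`),
and linear charts exist arbitrarily close to every point (`exists_linear`). Conversely, a slice
lifts locally to frames on a chart, and the base component of the lift is a transition map because
the slice is transverse to the orbits (`exists_isTransition_of_slice`). Maximality of the atlas then
absorbs every slice chart. -/

theorem completeSpace_endEuc (n : ℕ) : CompleteSpace (EndEuc n) := inferInstance

attribute [local instance] completeSpace_endEuc

theorem hasSummableGeomSeries_endEuc (n : ℕ) : HasSummableGeomSeries (EndEuc n) :=
  inferInstance

attribute [local instance] hasSummableGeomSeries_endEuc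

/-- The charted space structure of `GL_n(ℝ)`. -/
noncomputable abbrev chartedSpaceGLn (n : ℕ) : ChartedSpace (EndEuc n) (GLn n) :=
  inferInstance

attribute [local instance] chartedSpaceGLn

/-! ### Maps between open subsets of Euclidean space as maps of Euclidean space -/

section Extension

variable {n : ℕ}

theorem mfderiv_opens_val {U : Opens (Euc n)} (x : U) :
    mfderiv (modelEuc n) (modelEuc n) (Subtype.val : U → Euc n) x =
      ContinuousLinearMap.id ℝ (Euc n) := by
  have h : writtenInExtChartAt (modelEuc n) (modelEuc n) x (Subtype.val : U → Euc n)
      =ᶠ[𝓝 (x : Euc n)] id := by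
    have := U.chartAt_subtype_val_symm_eventuallyEq (H := Euc n) (x := x)
    simp only [chartAt_self_eq, OpenPartialHomeomorph.refl_apply,
      OpenPartialHomeomorph.refl_symm] at this
    filter_upwards [this] with y hy
    exact hy.symm
  have h2 : extChartAt (modelEuc n) x x = (x : Euc n) := rfl
  refine HasMFDerivAt.mfderiv ⟨continuous_subtype_val.continuousAt, ?_⟩
  rw [h2]
  exact ((hasFDerivAt_id (𝕜 := ℝ) (x : Euc n)).congr_of_eventuallyEq h).hasFDerivWithinAt

theorem contMDiffAt_opens_val_comp_iff {E H M : Type*} [NormedAddCommGroup E] [NormedSpace ℝ E]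
    [TopologicalSpace H] {I : ModelWithCorners ℝ E H} [TopologicalSpace M] [ChartedSpace H M]
    (U : Opens (Euc n)) (f : M → U) (x : M) :
    ContMDiffAt I (modelEuc n) ω (fun y => (f y : Euc n)) x ↔
      ContMDiffAt I (modelEuc n) ω f x :=
  ChartedSpace.liftPropWithinAt_subtypeVal_comp_iff ..

variable {X : Type*} [TopologicalSpace X]

/-- A retraction of `ℝⁿ` onto the domain of a chart, with an arbitrary value outside of it. -/
noncomputable def OrbifoldChart.toDom (c : OrbifoldChart n X) (y : Euc n) : c.dom := by
  classical
  exact if h : y ∈ c.dom then ⟨y, h⟩ else ⟨_, c.isConnected_dom.nonempty.some_mem⟩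

theorem OrbifoldChart.isOpen_dom (c : OrbifoldChart n X) : IsOpen (c.dom : Set (Euc n)) :=
  c.dom.isOpen

theorem OrbifoldChart.toDom_of_mem (c : OrbifoldChart n X) {y : Euc n} (h : y ∈ c.dom) :
    c.toDom y = ⟨y, h⟩ := dif_pos h

@[simp] theorem OrbifoldChart.toDom_coe (c : OrbifoldChart n X) (x : c.dom) :
    c.toDom x = x := c.toDom_of_mem x.2

theorem OrbifoldChart.coe_toDom (c : OrbifoldChart n X) {y : Euc n} (h : y ∈ c.dom) :
    (c.toDom y : Euc n) = y := by rw [c.toDom_of_mem h]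

theorem OrbifoldChart.coe_toDom_eventuallyEq (c : OrbifoldChart n X) {y : Euc n}
    (h : y ∈ c.dom) : (fun z => (c.toDom z : Euc n)) =ᶠ[𝓝 y] id := by
  filter_upwards [c.isOpen_dom.mem_nhds h] with z hz using c.coe_toDom hz

theorem OrbifoldChart.contMDiffAt_toDom (c : OrbifoldChart n X) {y : Euc n} (h : y ∈ c.dom) :
    ContMDiffAt (modelEuc n) (modelEuc n) ω c.toDom y := by
  rw [← contMDiffAt_opens_val_comp_iff]
  exact contMDiffAt_id.congr_of_eventuallyEq (c.coe_toDom_eventuallyEq h)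

theorem OrbifoldChart.continuousAt_toDom (c : OrbifoldChart n X) {y : Euc n} (h : y ∈ c.dom) :
    ContinuousAt c.toDom y :=
  (c.contMDiffAt_toDom h).continuousAt

/-- The map of `ℝⁿ` given by a map between the domains of two charts. -/
noncomputable def OrbifoldChart.ext (c : OrbifoldChart n X) {V : Opens (Euc n)}
    (F : c.dom → V) (y : Euc n) : Euc n := F (c.toDom y)

theorem OrbifoldChart.ext_coe (c : OrbifoldChart n X) {V : Opens (Euc n)}
    (F : c.dom → V) (x : c.dom) : c.ext F x = F x := by
  simp [OrbifoldChart.ext]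

theorem OrbifoldChart.contDiffAt_ext (c : OrbifoldChart n X) {V : Opens (Euc n)}
    {F : c.dom → V} (hF : IsAnalyticMap F) {y : Euc n} (h : y ∈ c.dom) :
    ContDiffAt ℝ ω (c.ext F) y := by
  rw [← contMDiffAt_iff_contDiffAt]
  exact (contMDiff_subtype_val _).comp _ ((hF _).comp _ (c.contMDiffAt_toDom h))

theorem OrbifoldChart.isAnalyticMap_of_ext (c : OrbifoldChart n X) {V : Opens (Euc n)}
    {F : c.dom → V} (h : ∀ x : c.dom, ContDiffAt ℝ ω (c.ext F) x) : IsAnalyticMap F := by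
  intro x
  rw [← contMDiffAt_opens_val_comp_iff]
  have h1 : ContMDiffAt (modelEuc n) (modelEuc n) ω (c.ext F) (x : Euc n) :=
    contMDiffAt_iff_contDiffAt.2 (h x)
  refine (h1.comp x (contMDiff_subtype_val x)).congr_of_eventuallyEq ?_
  exact Eventually.of_forall fun y => (c.ext_coe F y).symm

theorem OrbifoldChart.jac_eq_fderiv (c : OrbifoldChart n X) {V : Opens (Euc n)}
    {F : c.dom → V} (hF : IsAnalyticMap F) (x : c.dom) :
    jac F x = fderiv ℝ (c.ext F) x := by
  have h1 : Subtype.val ∘ F = c.ext F ∘ Subtype.val := by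
    funext y; exact (c.ext_coe F y).symm
  have hF' : MDifferentiableAt (modelEuc n) (modelEuc n) F x := hF.mdifferentiable x
  have hv : MDifferentiableAt (modelEuc n) (modelEuc n) (Subtype.val : V → Euc n) (F x) :=
    (contMDiff_subtype_val (n := 1) _).mdifferentiableAt (by simp)
  have hu : MDifferentiableAt (modelEuc n) (modelEuc n) (Subtype.val : c.dom → Euc n) x :=
    (contMDiff_subtype_val (n := 1) _).mdifferentiableAt (by simp)
  have he : MDifferentiableAt (modelEuc n) (modelEuc n) (c.ext F) (x : Euc n) :=
    ((c.contDiffAt_ext hF x.2).differentiableAt (by simp)).mdifferentiableAt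
  have h2 := mfderiv_comp x hv hF'
  have h3 := mfderiv_comp x he hu
  rw [mfderiv_opens_val] at h2 h3
  rw [h1, h3, mfderiv_eq_fderiv] at h2
  exact h2.symm

/-- The action of the group of a chart, as maps of `ℝⁿ`. -/
noncomputable def OrbifoldChart.act (c : OrbifoldChart n X) (g : c.G) : Euc n → Euc n :=
  c.ext fun x : c.dom => g • x

theorem OrbifoldChart.act_coe (c : OrbifoldChart n X) (g : c.G) (x : c.dom) :
    c.act g x = (g • x : c.dom) := c.ext_coe _ x

theorem OrbifoldChart.act_mem (c : OrbifoldChart n X) (g : c.G) (y : Euc n) :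
    c.act g y ∈ c.dom := (g • c.toDom y).2

theorem OrbifoldChart.toDom_act (c : OrbifoldChart n X) (g : c.G) (y : Euc n) :
    c.toDom (c.act g y) = g • c.toDom y := c.toDom_coe (g • c.toDom y)

theorem OrbifoldChart.act_one (c : OrbifoldChart n X) {y : Euc n} (h : y ∈ c.dom) :
    c.act 1 y = y := by
  simp [act, ext, c.coe_toDom h]

theorem OrbifoldChart.act_mul (c : OrbifoldChart n X) (g h : c.G) (y : Euc n) :
    c.act (g * h) y = c.act g (c.act h y) := by
  simp [act, ext, mul_smul]

theorem OrbifoldChart.proj_toDom_act (c : OrbifoldChart n X) (g : c.G) (y : Euc n) :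
    c.proj (c.toDom (c.act g y)) = c.proj (c.toDom y) := by
  rw [c.toDom_act, c.proj_smul]

theorem OrbifoldChart.contDiffAt_act (c : OrbifoldChart n X) (g : c.G) {y : Euc n}
    (h : y ∈ c.dom) : ContDiffAt ℝ ω (c.act g) y :=
  c.contDiffAt_ext (c.analytic_smul g) h

theorem OrbifoldChart.isUnit_fderiv_act (c : OrbifoldChart n X) (g : c.G) {y : Euc n}
    (h : y ∈ c.dom) : IsUnit (fderiv ℝ (c.act g) y) := by
  have := c.jac_eq_fderiv (c.analytic_smul g) ⟨y, h⟩
  exact this ▸ c.isUnit_jac_smul g ⟨y, h⟩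

instance OrbifoldChart.continuousConstSMul (c : OrbifoldChart n X) :
    ContinuousConstSMul c.G c.dom := ⟨fun g => (c.analytic_smul g).continuous⟩

theorem OrbifoldChart.proj_eq_iff (c : OrbifoldChart n X) {x y : c.dom} :
    c.proj x = c.proj y ↔ ∃ g : c.G, g • x = y := by
  constructor
  · intro h
    have := c.isOpenEmbedding_lift.injective (a₁ := Quotient.mk _ y) (a₂ := Quotient.mk _ x) h.symm
    exact Quotient.exact this
  · rintro ⟨g, rfl⟩
    exact (c.proj_smul g x).symm

theorem OrbifoldChart.continuous_proj (c : OrbifoldChart n X) : Continuous c.proj :=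
  c.isOpenEmbedding_lift.continuous.comp continuous_quotient_mk'

theorem OrbifoldChart.isOpenMap_proj (c : OrbifoldChart n X) : IsOpenMap c.proj :=
  c.isOpenEmbedding_lift.isOpenMap.comp
    (MulAction.isOpenQuotientMap_quotientMk (Γ := c.G) (T := c.dom)).isOpenMap

theorem OrbifoldChart.isOpen_range_proj (c : OrbifoldChart n X) : IsOpen (range c.proj) :=
  c.isOpenMap_proj.isOpen_range

end Extension

/-! ### Rigidity of lifts and transition maps -/

section Transition

variable {n : ℕ} {X : Type*} [TopologicalSpace X]

/-- The identity theorem on the connected domain spreads the equality of germs to the whole domain,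
where faithfulness applies. -/
theorem OrbifoldChart.eq_one_of_act_eventuallyEq (c : OrbifoldChart n X)
    [FaithfulSMul c.G c.dom] {g : c.G} {x : Euc n} (hx : x ∈ c.dom)
    (h : c.act g =ᶠ[𝓝 x] id) : g = 1 := by
  have h1 : AnalyticOnNhd ℝ (c.act g) c.dom := fun y hy => (c.contDiffAt_act g hy).analyticAt
  have h2 : AnalyticOnNhd ℝ (id : Euc n → Euc n) c.dom := fun y _ => analyticAt_id
  have h3 := h1.eqOn_of_preconnected_of_eventuallyEq h2 c.isConnected_dom.isPreconnected hx h
  refine FaithfulSMul.eq_of_smul_eq_smul (α := c.dom) fun y => Subtype.ext ?_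
  rw [← c.act_coe, h3 y.2, one_smul]
  rfl

/-- Two real analytic lifts of the same map on a connected open set differ by an element of the
group of the chart. -/
theorem OrbifoldChart.exists_eqOn_act (d : OrbifoldChart n X) {W : Set (Euc n)} (hW : IsOpen W)
    (hWc : IsConnected W) {f₁ f₂ : Euc n → Euc n}
    (h₁ : ∀ w ∈ W, ContDiffAt ℝ ω f₁ w) (h₂ : ∀ w ∈ W, ContDiffAt ℝ ω f₂ w)
    (m₁ : MapsTo f₁ W d.dom) (m₂ : MapsTo f₂ W d.dom)
    (hp : ∀ w ∈ W, d.proj (d.toDom (f₂ w)) = d.proj (d.toDom (f₁ w))) :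
    ∃ h : d.G, EqOn f₂ (d.act h ∘ f₁) W := by
  have hc : ∀ h : d.G, ∀ w ∈ W, ContDiffAt ℝ ω (d.act h ∘ f₁) w := fun h w hw =>
    (d.contDiffAt_act h (m₁ hw)).comp w (h₁ w hw)
  -- Pointwise, the two lifts differ by some group element, which may depend on the point; the
  -- agreement sets form a finite closed cover of `W`.
  have hcov : ⋃ h : d.G, {w : W | f₂ w = (d.act h ∘ f₁) w} = univ := by
    refine eq_univ_of_forall fun w => ?_
    obtain ⟨h, hh⟩ := d.proj_eq_iff.1 (hp w w.2).symm
    refine mem_iUnion.2 ⟨h, ?_⟩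
    have := congrArg (Subtype.val) hh
    rw [← d.toDom_act, d.coe_toDom (d.act_mem _ _), d.coe_toDom (m₂ w.2)] at this
    exact this.symm
  have hclosed : ∀ h : d.G, IsClosed {w : W | f₂ w = (d.act h ∘ f₁) w} := fun h =>
    isClosed_eq
      (continuousOn_iff_continuous_domRestrict.1 fun w hw => (h₂ w hw).continuousAt.continuousWithinAt)
      (continuousOn_iff_continuous_domRestrict.1 fun w hw =>
        (hc h w hw).continuousAt.continuousWithinAt)
  have : LocallyCompactSpace W := hW.locallyCompactSpace
  have : Nonempty W := hWc.nonempty.to_subtype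
  -- Baire: one agreement set has an interior point, and the identity theorem extends the agreement
  -- from there to all of `W`.
  obtain ⟨h, ⟨w, hw⟩⟩ := nonempty_interior_of_iUnion_of_closed hclosed hcov
  refine ⟨h, ?_⟩
  have a₁ : AnalyticOnNhd ℝ f₂ W := fun y hy => (h₂ y hy).analyticAt
  have a₂ : AnalyticOnNhd ℝ (d.act h ∘ f₁) W := fun y hy => (hc h y hy).analyticAt
  refine a₁.eqOn_of_preconnected_of_eventuallyEq a₂ hWc.isPreconnected w.2 ?_
  have := mem_interior_iff_mem_nhds.1 hw
  rw [nhds_subtype_eq_comap_nhdsWithin, hW.nhdsWithin_eq w.2] at this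
  obtain ⟨t, ht, hts⟩ := this
  filter_upwards [ht, hW.mem_nhds w.2] with y hy hyW
  exact hts (show (⟨y, hyW⟩ : W) ∈ _ from hy)

/-- `f` is, near `x`, a real analytic local diffeomorphism over `X` from the domain of the chart
`c` to the domain of the chart `d`. -/
structure IsTransition (c d : OrbifoldChart n X) (f : Euc n → Euc n) (x : Euc n) : Prop where
  contDiffAt : ContDiffAt ℝ ω f x
  isUnit : IsUnit (fderiv ℝ f x)
  proj : ∀ᶠ y in 𝓝 x, y ∈ c.dom ∧ f y ∈ d.dom ∧ d.proj (d.toDom (f y)) = c.proj (c.toDom y)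

variable {c d k : OrbifoldChart n X}

namespace IsTransition

variable {f g : Euc n → Euc n} {x : Euc n}

theorem mem (h : IsTransition c d f x) : x ∈ c.dom := h.proj.self_of_nhds.1

theorem map_mem (h : IsTransition c d f x) : f x ∈ d.dom := h.proj.self_of_nhds.2.1

theorem proj_eq (h : IsTransition c d f x) : d.proj (d.toDom (f x)) = c.proj (c.toDom x) :=
  h.proj.self_of_nhds.2.2

theorem differentiableAt (h : IsTransition c d f x) : DifferentiableAt ℝ f x :=
  h.contDiffAt.differentiableAt (by simp)

theorem continuousAt (h : IsTransition c d f x) : ContinuousAt f x := h.contDiffAt.continuousAt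

theorem congr (h : IsTransition c d f x) (hg : g =ᶠ[𝓝 x] f) : IsTransition c d g x where
  contDiffAt := h.contDiffAt.congr_of_eventuallyEq hg
  isUnit := hg.fderiv_eq (𝕜 := ℝ) ▸ h.isUnit
  proj := by filter_upwards [h.proj, hg] with y hy hyg; rwa [hyg]

theorem id (c : OrbifoldChart n X) (hx : x ∈ c.dom) : IsTransition c c id x where
  contDiffAt := contDiffAt_id
  isUnit := by rw [fderiv_id]; exact isUnit_one
  proj := by filter_upwards [c.isOpen_dom.mem_nhds hx] with y hy using ⟨hy, hy, rfl⟩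

theorem act (c : OrbifoldChart n X) (g : c.G) (hx : x ∈ c.dom) :
    IsTransition c c (c.act g) x where
  contDiffAt := c.contDiffAt_act g hx
  isUnit := c.isUnit_fderiv_act g hx
  proj := by
    filter_upwards [c.isOpen_dom.mem_nhds hx] with y hy
      using ⟨hy, c.act_mem g y, c.proj_toDom_act g y⟩

theorem comp (hg : IsTransition d k g (f x)) (hf : IsTransition c d f x) :
    IsTransition c k (g ∘ f) x where
  contDiffAt := hg.contDiffAt.comp x hf.contDiffAt
  isUnit := by
    rw [fderiv_comp x hg.differentiableAt hf.differentiableAt]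
    exact hg.isUnit.mul hf.isUnit
  proj := by
    filter_upwards [hf.proj, hf.continuousAt.eventually hg.proj] with y h1 h2
    exact ⟨h1.1, h2.2.1, h2.2.2.trans h1.2.2⟩

theorem fderiv_comp (hg : IsTransition d k g (f x)) (hf : IsTransition c d f x) :
    fderiv ℝ (g ∘ f) x = fderiv ℝ g (f x) * fderiv ℝ f x :=
  _root_.fderiv_comp x hg.differentiableAt hf.differentiableAt

theorem contDiffAt_fderiv (h : IsTransition c d f x) : ContDiffAt ℝ ω (fderiv ℝ f) x :=
  h.contDiffAt.fderiv_right (by simp)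

theorem eventually (h : IsTransition c d f x) : ∀ᶠ y in 𝓝 x, IsTransition c d f y := by
  filter_upwards [h.contDiffAt.eventually (by simp), eventually_eventually_nhds.2 h.proj,
    h.contDiffAt_fderiv.continuousAt.eventually (Units.isOpen.mem_nhds h.isUnit)] with y h1 h2 h3
  exact ⟨h1, h3, h2⟩

/-- Near its base point, a transition map agrees with a local homeomorphism. -/
theorem exists_openPartialHomeomorph (h : IsTransition c d f x) :
    ∃ P : OpenPartialHomeomorph (Euc n) (Euc n), x ∈ P.source ∧ (P : Euc n → Euc n) = f ∧
      ContDiffAt ℝ ω P.symm (f x) := by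
  obtain ⟨u, hu⟩ := h.isUnit
  have hf' : HasFDerivAt f ((ContinuousLinearEquiv.unitsEquiv ℝ (Euc n) u : Euc n ≃L[ℝ] Euc n) :
      Euc n →L[ℝ] Euc n) x := by
    have := h.differentiableAt.hasFDerivAt
    rw [← hu] at this
    exact this
  exact ⟨h.contDiffAt.toOpenPartialHomeomorph f hf' (by simp),
    h.contDiffAt.mem_toOpenPartialHomeomorph_source hf' (by simp), rfl,
    h.contDiffAt.to_localInverse hf' (by simp)⟩

theorem map_nhds_eq (h : IsTransition c d f x) : map f (𝓝 x) = 𝓝 (f x) := by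
  obtain ⟨P, hP, rfl, -⟩ := h.exists_openPartialHomeomorph
  exact P.map_nhds_eq hP

theorem symm (h : IsTransition c d f x) :
    ∃ g : Euc n → Euc n, IsTransition d c g (f x) ∧ g (f x) = x ∧ g ∘ f =ᶠ[𝓝 x] _root_.id := by
  obtain ⟨P, hP, hPf, hs⟩ := h.exists_openPartialHomeomorph
  subst hPf
  have hleft : ∀ᶠ y in 𝓝 x, P.symm (P y) = y := P.eventually_left_inverse hP
  have hright : ∀ᶠ y in 𝓝 (P x), P (P.symm y) = y :=
    P.eventually_right_inverse (P.map_source hP)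
  refine ⟨P.symm, ⟨hs, ?_, ?_⟩, P.left_inv hP, hleft⟩
  · have h1 : fderiv ℝ P.symm (P x) * fderiv ℝ P x = 1 := by
      rw [ContinuousLinearMap.mul_def, ← _root_.fderiv_comp x (hs.differentiableAt (by simp)) h.differentiableAt]
      have : (P.symm : Euc n → Euc n) ∘ P =ᶠ[𝓝 x] _root_.id := hleft
      rw [this.fderiv_eq]
      exact fderiv_id
    obtain ⟨u, hu⟩ := h.isUnit
    rw [← hu, Units.mul_eq_one_iff_eq_inv] at h1
    rw [h1]
    exact u⁻¹.isUnit
  · have h1 : ContinuousAt P.symm (P x) := hs.continuousAt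
    have h2 := h.proj
    rw [ContinuousAt, P.left_inv hP] at h1
    filter_upwards [hright, h1.eventually h2] with y h3 h4
    rw [h3] at h4
    exact ⟨h4.2.1, h4.1, h4.2.2.symm⟩

/-- Two transition maps with the same base point differ by an element of the group of the
target. -/
theorem exists_eventuallyEq_act (hf : IsTransition c d f x) (hg : IsTransition c d g x) :
    ∃ h : d.G, g =ᶠ[𝓝 x] d.act h ∘ f := by
  obtain ⟨r, hr, hball⟩ := Metric.eventually_nhds_iff_ball.1 (hf.eventually.and hg.eventually)
  obtain ⟨h, hh⟩ := d.exists_eqOn_act (W := Metric.ball x r) Metric.isOpen_ball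
    ((convex_ball x r).isConnected ⟨x, Metric.mem_ball_self hr⟩)
    (fun w hw => (hball w hw).1.contDiffAt) (fun w hw => (hball w hw).2.contDiffAt)
    (fun w hw => (hball w hw).1.map_mem) (fun w hw => (hball w hw).2.map_mem)
    (fun w hw => (hball w hw).2.proj_eq.trans (hball w hw).1.proj_eq.symm)
  exact ⟨h, hh.eventuallyEq_of_mem (Metric.ball_mem_nhds x hr)⟩

/-- A transition map is open at its base point, so an equality of germs after composing with `f` is
an equality of germs at `f x`. -/
theorem act_injective [FaithfulSMul d.G d.dom] (hf : IsTransition c d f x) {g h : d.G}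
    (hgh : d.act g ∘ f =ᶠ[𝓝 x] d.act h ∘ f) : g = h := by
  have h1 : d.act g =ᶠ[𝓝 (f x)] d.act h := by
    rw [← hf.map_nhds_eq]
    exact hgh
  have h2 : d.act (h⁻¹ * g) =ᶠ[𝓝 (f x)] _root_.id := by
    filter_upwards [h1, d.isOpen_dom.mem_nhds hf.map_mem] with y hy hyd
    rw [d.act_mul, hy, ← d.act_mul, inv_mul_cancel, d.act_one hyd, id_eq]
  exact (inv_mul_eq_one.1 (d.eq_one_of_act_eventuallyEq hf.map_mem h2)).symm

end IsTransition

theorem ChartEmbedding.isTransition (e : ChartEmbedding c d) {x : Euc n} (hx : x ∈ c.dom) :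
    IsTransition c d (c.ext e.map) x where
  contDiffAt := c.contDiffAt_ext e.analytic hx
  isUnit := by
    have := c.jac_eq_fderiv e.analytic ⟨x, hx⟩
    exact this ▸ e.isUnit_jac ⟨x, hx⟩
  proj := by
    filter_upwards [c.isOpen_dom.mem_nhds hx] with y hy
    refine ⟨hy, (e.map _).2, ?_⟩
    rw [OrbifoldChart.ext, d.toDom_coe, e.proj_map]

/-- `ker(G)` is mapped into the trivial group `ker(H)` by an injective homomorphism. -/
theorem ChartEmbedding.faithful (e : ChartEmbedding c d) [FaithfulSMul d.G d.dom] :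
    FaithfulSMul c.G c.dom := by
  refine ⟨fun {g h} hgh => ?_⟩
  have h1 : h⁻¹ * g ∈ c.ker := by
    refine Equiv.ext fun x => ?_
    change (h⁻¹ * g) • x = x
    rw [mul_smul, hgh, inv_smul_smul]
  have h2 : e.hom (h⁻¹ * g) ∈ d.ker := e.map_ker ▸ Subgroup.mem_map_of_mem _ h1
  have h3 : e.hom (h⁻¹ * g) = 1 := by
    refine FaithfulSMul.eq_of_smul_eq_smul (α := d.dom) fun y => ?_
    rw [one_smul]
    exact Equiv.congr_fun (show MulAction.toPermHom d.G d.dom (e.hom (h⁻¹ * g)) = 1 from h2) y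
  exact (inv_mul_eq_one.1 (e.hom_injective (h3.trans e.hom.map_one.symm))).symm

theorem OrbifoldChart.ker_eq_bot (c : OrbifoldChart n X) [FaithfulSMul c.G c.dom] :
    c.ker = ⊥ :=
  (MonoidHom.ker_eq_bot_iff _).2 MulAction.toPerm_injective

/-- An injective map which is everywhere a transition map is an embedding of reduced charts. -/
theorem exists_chartEmbedding [FaithfulSMul c.G c.dom] [FaithfulSMul d.G d.dom]
    {F : Euc n → Euc n} (hF : ∀ x ∈ c.dom, IsTransition c d F x) (hinj : InjOn F c.dom) :
    ∃ e : ChartEmbedding c d, ∀ x : c.dom, (e.map x : Euc n) = F x := by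
  -- The homomorphism `θ` comes from rigidity: `F ∘ g` and `F` are two lifts of the same map on the
  -- connected domain of `c`.
  have key : ∀ g : c.G, ∃ h : d.G, EqOn (F ∘ c.act g) (d.act h ∘ F) c.dom := fun g =>
    d.exists_eqOn_act c.isOpen_dom c.isConnected_dom (fun w hw => (hF w hw).contDiffAt)
      (fun w hw => ((hF _ (c.act_mem g w)).comp (.act c g hw)).contDiffAt)
      (fun w hw => (hF w hw).map_mem) (fun w hw => (hF _ (c.act_mem g w)).map_mem)
      (fun w hw => (((hF _ (c.act_mem g w)).comp (.act c g hw)).proj_eq).trans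
        (hF w hw).proj_eq.symm)
  choose θ hθ using key
  obtain ⟨x₀, hx₀⟩ := c.isConnected_dom.nonempty
  -- Uniqueness of the element provided by rigidity is what makes `θ` multiplicative.
  have huniq : ∀ (g h : d.G), EqOn (d.act g ∘ F) (d.act h ∘ F) c.dom → g = h := fun g h hgh =>
    (hF x₀ hx₀).act_injective (hgh.eventuallyEq_of_mem (c.isOpen_dom.mem_nhds hx₀))
  have hone : θ 1 = 1 := huniq _ _ fun y hy => by
    rw [← hθ 1 hy, Function.comp_apply, Function.comp_apply, c.act_one hy,
      d.act_one (hF y hy).map_mem]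
  have hmul : ∀ g h, θ (g * h) = θ g * θ h := fun g h => huniq _ _ fun y hy => by
    rw [← hθ _ hy, Function.comp_apply, Function.comp_apply, c.act_mul, d.act_mul]
    have h1 := hθ g (c.act_mem h y)
    have h2 := hθ h hy
    simp only [Function.comp_apply] at h1 h2
    rw [h1, h2]
  let F' : c.dom → d.dom := fun x => ⟨F x, (hF x x.2).map_mem⟩
  have hext : ∀ y ∈ c.dom, c.ext F' y = F y := fun y hy => by
    simp only [OrbifoldChart.ext, F', c.coe_toDom hy]
  have han : IsAnalyticMap F' := c.isAnalyticMap_of_ext fun x =>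
    (hF x x.2).contDiffAt.congr_of_eventuallyEq
      (eventually_of_mem (c.isOpen_dom.mem_nhds x.2) hext)
  refine ⟨{
    hom := { toFun := θ, map_one' := hone, map_mul' := hmul }
    hom_injective := ?_
    map_ker := by rw [c.ker_eq_bot, d.ker_eq_bot, Subgroup.map_bot]
    map := F'
    isEmbedding := ?_
    analytic := han
    immersive := ?_
    equivariant := ?_
    proj_map := ?_ }, fun x => rfl⟩
  · intro g h hgh
    refine FaithfulSMul.eq_of_smul_eq_smul (α := c.dom) fun y => Subtype.ext ?_
    have h1 := hθ g y.2
    have h2 := hθ h y.2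
    simp only [Function.comp_apply, c.act_coe] at h1 h2
    refine hinj (g • y).2 (h • y).2 (h1.trans (Eq.trans ?_ h2.symm))
    rw [show θ g = θ h from hgh]
  · have hop : IsOpenMap F' := by
      rw [isOpenMap_iff_nhds_le]
      intro x
      have h1 := (hF x x.2).map_nhds_eq
      rw [nhds_subtype, nhds_subtype, ← comap_map (Subtype.val_injective) (f := map F' _),
        map_map]
      refine comap_mono ?_
      change 𝓝 (F x) ≤ _
      rw [← h1, show Subtype.val ∘ F' = F ∘ Subtype.val from rfl, ← map_map]
      refine map_mono ?_
      rw [← nhds_subtype, map_nhds_subtype_coe_eq_nhds x.2 (c.isOpen_dom.mem_nhds x.2)]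
    exact (IsOpenEmbedding.of_continuous_injective_isOpenMap han.continuous
      (fun x y hxy => Subtype.ext (hinj x.2 y.2 (congrArg Subtype.val hxy))) hop).isEmbedding
  · intro x
    have h1 := (hF x x.2).isUnit
    rw [c.jac_eq_fderiv han, Filter.EventuallyEq.fderiv_eq
      (eventually_of_mem (c.isOpen_dom.mem_nhds x.2) hext)]
    exact (ContinuousLinearMap.isUnit_iff_bijective.1 h1).1
  · intro g x
    have h1 := hθ g x.2
    simp only [Function.comp_apply, c.act_coe] at h1
    refine Subtype.ext (h1.trans ?_)
    exact d.act_coe (θ g) (F' x)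
  · intro x
    have h1 := (hF x x.2).proj_eq
    rw [c.toDom_coe, d.toDom_of_mem (hF x x.2).map_mem] at h1
    exact h1

/-- Points over the same point of `X` in two charts of an orbifold are related by a transition
map. -/
theorem AnalyticOrbifold.exists_isTransition (O : AnalyticOrbifold n X) {c d : OrbifoldChart n X}
    (hc : c ∈ O.atlas) (hd : d ∈ O.atlas) {x y : Euc n} (hx : x ∈ c.dom) (hy : y ∈ d.dom)
    (h : c.proj (c.toDom x) = d.proj (d.toDom y)) :
    ∃ f, IsTransition c d f x ∧ f x = y := by
  obtain ⟨k, -, ⟨w, hw⟩, ⟨a⟩, ⟨b⟩⟩ := O.isAtlas.compat c hc d hd (c.proj (c.toDom x))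
    ⟨mem_range_self _, h ▸ mem_range_self _⟩
  have ha := a.isTransition w.2
  have hb := b.isTransition w.2
  -- The embeddings of `k` hit the correct orbits but perhaps not `x` and `y` themselves; group
  -- elements correct this. The desired map is the local inverse of the first corrected embedding
  -- followed by the second.
  obtain ⟨g, hg⟩ := c.proj_eq_iff.1 ((a.proj_map w).trans hw)
  obtain ⟨g', hg'⟩ := d.proj_eq_iff.1 (((b.proj_map w).trans hw).trans h)
  have ha' := IsTransition.comp (.act c g ha.map_mem) ha
  have hb' := IsTransition.comp (.act d g' hb.map_mem) hb
  have hax : (c.act g ∘ k.ext a.map) w = x := by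
    rw [Function.comp_apply, k.ext_coe, c.act_coe, hg, c.coe_toDom hx]
  have hby : (d.act g' ∘ k.ext b.map) w = y := by
    rw [Function.comp_apply, k.ext_coe, d.act_coe, hg', d.coe_toDom hy]
  obtain ⟨s, hs, hsx, -⟩ := ha'.symm
  rw [hax] at hs hsx
  refine ⟨_, IsTransition.comp (by rw [hsx]; exact hb') hs, ?_⟩
  rw [Function.comp_apply, hsx, hby]

end Transition

/-! ### Linearization of finite group actions -/

/-- An element moving `x` also moves a small neighbourhood off itself; finitely many such
neighbourhoods are intersected. -/
theorem exists_nhds_smul_eq_of_mem {G M : Type*} [Group G] [Finite G] [TopologicalSpace M]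
    [T2Space M] [MulAction G M] [ContinuousConstSMul G M] (x : M) :
    ∃ N ∈ 𝓝 x, ∀ g : G, ∀ y ∈ N, g • y ∈ N → g • x = x := by
  have h : ∀ g : G, ∃ N ∈ 𝓝 x, ∀ y ∈ N, g • y ∈ N → g • x = x := by
    intro g
    by_cases hg : g • x = x
    · exact ⟨univ, univ_mem, fun _ _ _ => hg⟩
    · obtain ⟨U, V, hU, hV, hxU, hxV, hUV⟩ := t2_separation hg
      refine ⟨V ∩ (fun y => g • y) ⁻¹' U, inter_mem (hV.mem_nhds hxV)
        ((continuous_const_smul g).continuousAt.preimage_mem_nhds (hU.mem_nhds hxU)), ?_⟩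
      intro y hy hgy
      exact (disjoint_left.1 hUV hy.2 hgy.1).elim
  choose N hN h using h
  refine ⟨⋂ g, N g, iInter_mem.2 hN, fun g y hy hgy => ?_⟩
  exact h g y (mem_iInter.1 hy g) (mem_iInter.1 hgy g)

section Linearization

variable {n : ℕ} {X : Type*} [TopologicalSpace X]

/-- The isotropy representation of a chart at a point. -/
noncomputable def OrbifoldChart.isotropyRep (c : OrbifoldChart n X) (x : c.dom) :
    MulAction.stabilizer c.G x →* EndEuc n where
  toFun g := fderiv ℝ (c.act g) x
  map_one' := by
    have : c.act 1 =ᶠ[𝓝 (x : Euc n)] id := by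
      filter_upwards [c.isOpen_dom.mem_nhds x.2] with y hy using c.act_one hy
    rw [OneMemClass.coe_one, this.fderiv_eq]
    exact fderiv_id
  map_mul' g h := by
    have h1 : c.act (g * h : c.G) = c.act g ∘ c.act h := funext (c.act_mul _ _)
    have h2 : c.act h x = x := by rw [c.act_coe]; exact congrArg _ h.2
    rw [Subgroup.coe_mul, h1, IsTransition.fderiv_comp (c := c) (d := c) (k := c)
      (by rw [h2]; exact .act c g x.2) (.act c h x.2), h2]

theorem OrbifoldChart.act_stabilizer (c : OrbifoldChart n X) (x : c.dom)
    (g : MulAction.stabilizer c.G x) : c.act g x = x := by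
  rw [c.act_coe]; exact congrArg _ g.2

/-- Averaging linearizes the action of an isotropy group. -/
theorem OrbifoldChart.exists_linearization (c : OrbifoldChart n X) (x : c.dom) :
    ∃ Φ : Euc n → Euc n, (∀ y ∈ c.dom, ContDiffAt ℝ ω Φ y) ∧ Φ x = 0 ∧ fderiv ℝ Φ x = 1 ∧
      ∀ (g : MulAction.stabilizer c.G x) (y : Euc n),
        Φ (c.act g y) = c.isotropyRep x g (Φ y) := by
  have := Fintype.ofFinite (MulAction.stabilizer c.G x)
  have hd : ∀ g : MulAction.stabilizer c.G x, ∀ y ∈ c.dom,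
      ContDiffAt ℝ ω (fun y => c.isotropyRep x g⁻¹ (c.act g y - x)) y := fun g y hy =>
    (c.isotropyRep x g⁻¹).contDiff.contDiffAt.comp y
      ((c.contDiffAt_act g hy).sub contDiffAt_const)
  -- `Φ(y)` is the average over the isotropy group of `(dg)_x⁻¹ (g y - x)`; each summand has
  -- derivative `1` at `x`.
  refine ⟨fun y => (Fintype.card (MulAction.stabilizer c.G x) : ℝ)⁻¹ •
    ∑ g : MulAction.stabilizer c.G x, c.isotropyRep x g⁻¹ (c.act g y - x), ?_, ?_, ?_, ?_⟩
  · exact fun y hy => (ContDiffAt.sum fun g _ => hd g y hy).const_smul _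
  · simp [c.act_stabilizer]
  · have h1 : ∀ g : MulAction.stabilizer c.G x,
        HasFDerivAt (fun y => c.isotropyRep x g⁻¹ (c.act g y - x)) (1 : EndEuc n) (x : Euc n) := by
      intro g
      have h2 : HasFDerivAt (c.act g) (c.isotropyRep x g) (x : Euc n) :=
        ((c.contDiffAt_act g x.2).differentiableAt (by simp)).hasFDerivAt
      have h3 := (c.isotropyRep x g⁻¹).hasFDerivAt.comp (x : Euc n) (h2.sub_const (x : Euc n))
      have h4 : c.isotropyRep x g⁻¹ * c.isotropyRep x g = 1 := by
        rw [← map_mul, inv_mul_cancel, map_one]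
      rw [← ContinuousLinearMap.mul_def, h4] at h3
      exact h3
    have h2 := (HasFDerivAt.fun_sum (u := Finset.univ) fun g _ => h1 g).const_smul
      (Fintype.card (MulAction.stabilizer c.G x) : ℝ)⁻¹
    refine (HasFDerivAt.fderiv h2).trans ?_
    rw [Finset.sum_const, Finset.card_univ, ← Nat.cast_smul_eq_nsmul ℝ, smul_smul,
      inv_mul_cancel₀ (by simp [Fintype.card_ne_zero]), one_smul]
  · intro h y
    simp only [map_smul, map_sum]
    congr 1
    -- Replacing `g` by `g h⁻¹` turns the summand into `(dh)_x (dg)_x⁻¹ (g y - x)`.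
    rw [← Equiv.sum_comp (Equiv.mulRight h⁻¹)]
    refine Finset.sum_congr rfl fun g _ => ?_
    simp only [Equiv.coe_mulRight, mul_inv_rev, inv_inv, map_mul, Subgroup.coe_mul,
      mul_apply_eq_comp, ← c.act_mul, InvMemClass.coe_inv, inv_mul_cancel_right]

theorem exists_openPartialHomeomorph_of_fderiv_eq_one {Φ : Euc n → Euc n} {x : Euc n}
    (h : ContDiffAt ℝ ω Φ x) (h1 : fderiv ℝ Φ x = 1) :
    ∃ P : OpenPartialHomeomorph (Euc n) (Euc n), x ∈ P.source ∧ (P : Euc n → Euc n) = Φ ∧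
      ContDiffAt ℝ ω P.symm (Φ x) := by
  have hf' : HasFDerivAt Φ ((ContinuousLinearEquiv.refl ℝ (Euc n) : Euc n ≃L[ℝ] Euc n) :
      Euc n →L[ℝ] Euc n) x := by
    have := (h.differentiableAt (by simp)).hasFDerivAt
    rw [h1] at this
    exact this
  exact ⟨h.toOpenPartialHomeomorph Φ hf' (by simp),
    h.mem_toOpenPartialHomeomorph_source hf' (by simp), rfl, h.to_localInverse hf' (by simp)⟩

/-- An element of the group of a reduced chart with a fixed point at which its derivative is the
identity is trivial. -/
theorem OrbifoldChart.eq_one_of_isotropyRep_eq_one (c : OrbifoldChart n X)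
    [FaithfulSMul c.G c.dom] (x : c.dom) (g : MulAction.stabilizer c.G x)
    (hg : c.isotropyRep x g = 1) : g = 1 := by
  obtain ⟨Φ, hΦ, -, hΦ1, hΦe⟩ := c.exists_linearization x
  obtain ⟨P, hP, hPf, -⟩ := exists_openPartialHomeomorph_of_fderiv_eq_one (hΦ x x.2) hΦ1
  refine Subtype.ext (c.eq_one_of_act_eventuallyEq x.2 ?_)
  have h1 : ∀ᶠ y in 𝓝 (x : Euc n), c.act g y ∈ P.source :=
    (c.contDiffAt_act g x.2).continuousAt.eventually
      (by rw [c.act_stabilizer]; exact P.open_source.mem_nhds hP)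
  filter_upwards [h1, P.open_source.mem_nhds hP] with y hy1 hy2
  -- In the coordinate `Φ` the element `g` acts by its derivative, which is the identity, so `g`
  -- fixes all points near `x`.
  refine P.injOn hy1 hy2 ?_
  rw [hPf, id_eq, hΦe, hg, one_apply_eq_self]

/-- This freeness is where reducedness makes the frame bundle a manifold: fixing `(x, B)` means
fixing `x` with derivative `1`, since `B` can be cancelled. -/
theorem OrbifoldChart.frame_smul_eq_self_iff (c : OrbifoldChart n X)
    [FaithfulSMul c.G c.dom] {g : c.G} {z : Frame c.dom} : g • z = z ↔ g = 1 := by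
  refine ⟨fun h => ?_, fun h => by rw [h, one_smul]⟩
  have h1 : g • z.1 = z.1 := congrArg Prod.fst h
  have h2 : jac (fun y : c.dom => g • y) z.1 * (z.2 : EndEuc n) = z.2 :=
    congrArg Units.val (congrArg Prod.snd h)
  rw [show jac (fun y : c.dom => g • y) z.1 * (z.2 : EndEuc n) = z.2 ↔
    jac (fun y : c.dom => g • y) z.1 = 1 from z.2.isUnit.mul_eq_right, c.jac_eq_fderiv (c.analytic_smul g)] at h2
  exact congrArg Subtype.val (c.eq_one_of_isotropyRep_eq_one z.1 ⟨g, h1⟩ h2)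

end Linearization

/-! ### Linear charts -/

section LinearCharts

variable {n : ℕ} {X : Type*} [TopologicalSpace X]

/-- `ℝⁿ` embeds equivariantly into arbitrarily small balls around the origin. -/
theorem exists_equivariant_contraction {H : Type*} [Group H] [Finite H] (ρ : H →* EndEuc n)
    {r : ℝ} (hr : 0 < r) :
    ∃ β κ : Euc n → Euc n, ContDiff ℝ ω β ∧ (∀ v, ContDiffAt ℝ ω κ (β v)) ∧
      (∀ v, κ (β v) = v) ∧ β 0 = 0 ∧ (∀ h v, β (ρ h v) = ρ h (β v)) ∧ ∀ v, ‖β v‖ < r := by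
  have := Fintype.ofFinite H
  -- An invariant positive quadratic form, scaled so that `q v < 1` forces `‖v‖ < r`.
  let q : Euc n → ℝ := fun v => (r ^ 2)⁻¹ * ∑ h, ‖ρ h v‖ ^ 2
  have hq : ContDiff ℝ ω q :=
    contDiff_const.mul (ContDiff.sum fun h _ => (ρ h).contDiff.norm_sq ℝ)
  have hq0 : ∀ v, 0 ≤ q v := fun v => by positivity
  have hqρ : ∀ h v, q (ρ h v) = q v := by
    intro h v
    simp only [q]
    congr 1
    rw [← Equiv.sum_comp (Equiv.mulRight h) fun g => ‖ρ g v‖ ^ 2]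
    simp
  have hqs : ∀ (a : ℝ) v, q (a • v) = a ^ 2 * q v := by
    intro a v
    simp only [q, map_smul, norm_smul, mul_pow, Real.norm_eq_abs, sq_abs, ← Finset.mul_sum]
    ring
  have hqn : ∀ v, ‖v‖ ^ 2 ≤ r ^ 2 * q v := by
    intro v
    have h1 : ‖ρ 1 v‖ ^ 2 ≤ ∑ h, ‖ρ h v‖ ^ 2 :=
      Finset.single_le_sum (f := fun h => ‖ρ h v‖ ^ 2) (fun h _ => by positivity)
        (Finset.mem_univ 1)
    rw [map_one, one_apply_eq_self] at h1
    simp only [q]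
    rwa [mul_inv_cancel_left₀ (by positivity)]
  have hqβ : ∀ v, q ((√(1 + q v))⁻¹ • v) = q v / (1 + q v) := by
    intro v
    rw [hqs, inv_pow, Real.sq_sqrt (by linarith [hq0 v])]
    field_simp
  have hlt : ∀ v, 0 < 1 - q ((√(1 + q v))⁻¹ • v) := by
    intro v
    have := hq0 v
    rw [hqβ, sub_pos, div_lt_one (by linarith)]
    linarith
  -- `β` maps `ℝⁿ` into the open unit ball of `q`, since `q (β v) = q v / (1 + q v)`. From `1 - q (β
  -- v) = (1 + q v)⁻¹` one reads off the inverse `κ`.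
  refine ⟨fun v => (√(1 + q v))⁻¹ • v, fun w => (√(1 - q w))⁻¹ • w, ?_, ?_, ?_, by simp, ?_, ?_⟩
  · refine ContDiff.smul (g := fun v => v) (ContDiff.inv (f := fun v => √(1 + q v)) ?_
      fun v => ?_) contDiff_id
    · exact (contDiff_const.add hq).sqrt fun v => by linarith [hq0 v]
    · exact (Real.sqrt_pos.2 (by linarith [hq0 v])).ne'
  · intro v
    refine ContDiffAt.smul (g := fun v => v) (ContDiffAt.inv (f := fun w => √(1 - q w)) ?_ ?_)
      contDiffAt_id
    · exact (contDiffAt_const.sub hq.contDiffAt).sqrt (hlt v).ne'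
    · exact (Real.sqrt_pos.2 (hlt v)).ne'
  · intro v
    have h1 : 1 - q ((√(1 + q v))⁻¹ • v) = (1 + q v)⁻¹ := by
      rw [hqβ]
      have := hq0 v
      field_simp
      ring
    have h2 : 0 < √(1 + q v) := Real.sqrt_pos.2 (by linarith [hq0 v])
    simp only [h1, Real.sqrt_inv, inv_inv, smul_smul]
    rw [mul_inv_cancel₀ h2.ne', one_smul]
  · intro h v
    simp only [hqρ, map_smul]
  · intro v
    have h1 := hqn ((√(1 + q v))⁻¹ • v)
    have h2 := hlt v
    refine lt_of_pow_lt_pow_left₀ 2 hr.le (lt_of_le_of_lt h1 ?_)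
    have : 0 < r ^ 2 := by positivity
    nlinarith

/-- A chart is linear if its domain is `ℝⁿ` and its group acts linearly. -/
def OrbifoldChart.IsLinear (c : OrbifoldChart n X) : Prop :=
  c.dom = ⊤ ∧ ∀ g : c.G, ∃ L : EndEuc n, ∀ u : c.dom, ((g • u : c.dom) : Euc n) = L u

/-- The chart with domain `ℝⁿ` given by a representation of a finite group. -/
noncomputable def linearChart {H : Type} [Group H] [Finite H] (ρ : H →* EndEuc n) (p : Euc n → X)
    (hinv : ∀ h v, p (ρ h v) = p v) (hinj : ∀ u v, p u = p v → ∃ h, ρ h u = v)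
    (hcont : Continuous p) (hopen : IsOpenMap p) : OrbifoldChart n X :=
  letI act : MulAction H (⊤ : Opens (Euc n)) :=
    { smul := fun h v => ⟨ρ h v, trivial⟩
      one_smul := fun v => Subtype.ext (by
        change ρ 1 v = v
        rw [map_one, one_apply_eq_self])
      mul_smul := fun g h v => Subtype.ext (by
        change ρ (g * h) v = ρ g (ρ h v)
        rw [map_mul, mul_apply_eq_comp]) }
  { dom := ⊤
    isConnected_dom := by
      rw [Opens.coe_top]
      exact isConnected_univ
    G := H
    analytic_smul := fun h x => by
      rw [← contMDiffAt_opens_val_comp_iff]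
      exact ((ρ h).contDiff.contMDiff.comp (contMDiff_subtype_val)) x
    proj := fun v => p v
    proj_smul := fun h v => hinv h v
    isOpenEmbedding_lift := by
      refine IsOpenEmbedding.of_continuous_injective_isOpenMap ?_ ?_ ?_
      · exact (hcont.comp continuous_subtype_val).quotient_lift _
      · intro a b
        induction a using Quotient.inductionOn with | h a => ?_
        induction b using Quotient.inductionOn with | h b => ?_
        intro hab
        obtain ⟨h, hh⟩ := hinj b a hab.symm
        exact Quotient.sound (s := MulAction.orbitRel H (⊤ : Opens (Euc n)))
          ⟨h, Subtype.ext hh⟩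
      · intro W hW
        have h1 := hopen _ ((Opens.isOpen ⊤).isOpenMap_subtype_val _
          (hW.preimage (continuous_quotient_mk' (s := MulAction.orbitRel H (⊤ : Opens (Euc n))))))
        convert h1 using 1
        ext y
        constructor
        · rintro ⟨a, ha, rfl⟩
          induction a using Quotient.inductionOn with | h a => ?_
          exact ⟨a, ⟨a, ha, rfl⟩, rfl⟩
        · rintro ⟨_, ⟨a, ha, rfl⟩, rfl⟩
          exact ⟨_, ha, rfl⟩ }

/-- Around every point, a reduced chart contains arbitrarily small linear charts. -/
theorem OrbifoldChart.exists_linear (c : OrbifoldChart n X) [FaithfulSMul c.G c.dom] (x : c.dom)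
    {N : Set (Euc n)} (hN : N ∈ 𝓝 (x : Euc n)) :
    ∃ e : OrbifoldChart n X, e.IsLinear ∧ FaithfulSMul e.G e.dom ∧ ∃ F : Euc n → Euc n,
      (∀ v, IsTransition e c F v ∧ F v ∈ N) ∧ Function.Injective F ∧ F 0 = x := by
  obtain ⟨Φ, hΦ, hΦ0, hΦ1, hΦe⟩ := c.exists_linearization x
  obtain ⟨P, hxP, rfl, hPs⟩ := exists_openPartialHomeomorph_of_fderiv_eq_one (hΦ x x.2) hΦ1
  obtain ⟨N₁, hN₁, hN₁s⟩ := exists_nhds_smul_eq_of_mem (G := c.G) x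
  have hN₂ : ∀ᶠ y in 𝓝 (x : Euc n), y ∈ P.source ∧ y ∈ N ∧ y ∈ c.dom ∧ c.toDom y ∈ N₁ := by
    refine Eventually.and (P.open_source.mem_nhds hxP) (Eventually.and hN
      (Eventually.and (c.isOpen_dom.mem_nhds x.2) ?_))
    exact (c.continuousAt_toDom x.2).eventually (by rwa [c.toDom_coe])
  have hN₃ : ∀ᶠ y in 𝓝 (x : Euc n), ∀ g : MulAction.stabilizer c.G x,
      c.act g y ∈ P.source := by
    refine eventually_all.2 fun g => (c.contDiffAt_act g x.2).continuousAt.eventually ?_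
    rw [c.act_stabilizer]
    exact P.open_source.mem_nhds hxP
  have hsymm : ContinuousAt P.symm 0 := hΦ0 ▸ hPs.continuousAt
  have hsx : P.symm 0 = x := by rw [← hΦ0, P.left_inv hxP]
  rw [hΦ0] at hPs
  have hev : ∀ᶠ w in 𝓝 (0 : Euc n), w ∈ P.target ∧ ContDiffAt ℝ ω P.symm w ∧
      (P.symm w ∈ N ∧ P.symm w ∈ c.dom ∧ c.toDom (P.symm w) ∈ N₁) ∧
      ∀ g : MulAction.stabilizer c.G x, c.act g (P.symm w) ∈ P.source := by
    have h1 : Tendsto P.symm (𝓝 0) (𝓝 (x : Euc n)) := hsx ▸ hsymm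
    filter_upwards [P.open_target.mem_nhds (hΦ0 ▸ P.map_source hxP), hPs.eventually (by simp),
      h1.eventually hN₂, h1.eventually hN₃] with w h1 h2 h3 h4
    exact ⟨h1, h2, h3.2, h4⟩
  obtain ⟨r, hr, hball⟩ := Metric.eventually_nhds_iff_ball.1 hev
  -- The small linear chart is parametrized by `P.symm ∘ β`: contract `ℝⁿ` into the ball, then undo
  -- the linearization. Its left inverse is `κ ∘ P`.
  obtain ⟨β, κ, hβ, hκ, hκβ, hβ0, hβe, hβr⟩ := exists_equivariant_contraction (c.isotropyRep x) hr
  have hB : ∀ v, _ := fun v => hball (β v) (mem_ball_zero_iff.2 (hβr v))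
  have hFe : ∀ g v, P.symm (β (c.isotropyRep x g v)) = c.act g (P.symm (β v)) := by
    intro g v
    have h1 := hΦe g (P.symm (β v))
    rw [P.right_inv (hB v).1, ← hβe] at h1
    rw [← h1, P.left_inv ((hB v).2.2.2 g)]
  have hFd : ∀ v, ContDiffAt ℝ ω (P.symm ∘ β) v := fun v =>
    (hB v).2.1.comp v hβ.contDiffAt
  have hFl : ∀ v, κ (P (P.symm (β v))) = v := fun v => by rw [P.right_inv (hB v).1, hκβ]
  have hFu : ∀ v, IsUnit (fderiv ℝ (P.symm ∘ β) v) := by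
    intro v
    have h1 : ContDiffAt ℝ ω (κ ∘ P) ((P.symm ∘ β) v) := by
      refine ContDiffAt.comp _ ?_ (hΦ _ (hB v).2.2.1.2.1)
      rw [Function.comp_apply, P.right_inv (hB v).1]
      exact hκ v
    have h2 : (κ ∘ P) ∘ P.symm ∘ β = id := funext hFl
    have h3 := _root_.fderiv_comp v (h1.differentiableAt (by simp))
      ((hFd v).differentiableAt (by simp))
    rw [h2, fderiv_id] at h3
    -- The derivative has a left inverse, and in finite dimension this makes it invertible.
    have hinj : Function.Injective (fderiv ℝ (P.symm ∘ β) v) := fun a b hab => by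
      have h4 := DFunLike.congr_fun h3 a
      have h5 := DFunLike.congr_fun h3 b
      simp only [ContinuousLinearMap.coe_id', id_eq, ContinuousLinearMap.comp_apply] at h4 h5
      rw [h4, h5, hab]
    exact ContinuousLinearMap.isUnit_iff_bijective.2
      ⟨hinj, (LinearMap.injective_iff_surjective
        (f := (fderiv ℝ (P.symm ∘ β) v).toLinearMap)).1 hinj⟩
  have hFo : IsOpenMap (P.symm ∘ β) := by
    rw [isOpenMap_iff_nhds_le]
    intro v
    obtain ⟨u, hu⟩ := hFu v
    have h1 := (hFd v).hasStrictFDerivAt (by simp)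
    rw [← hu] at h1
    exact (HasStrictFDerivAt.map_nhds_eq_of_equiv
      (f' := ContinuousLinearEquiv.unitsEquiv ℝ (Euc n) u) h1).ge
  have hpc : Continuous (fun v => c.proj (c.toDom (P.symm (β v)))) := by
    refine c.continuous_proj.comp (continuous_iff_continuousAt.2 fun v => ?_)
    exact ContinuousAt.comp (f := P.symm ∘ β) (c.continuousAt_toDom (hB v).2.2.1.2.1)
      (hFd v).continuousAt
  have hpo : IsOpenMap (fun v => c.proj (c.toDom (P.symm (β v)))) := by
    refine c.isOpenMap_proj.comp fun W hW => ?_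
    convert (hFo W hW).preimage continuous_subtype_val using 1
    ext y
    constructor
    · rintro ⟨v, hv, rfl⟩
      exact ⟨v, hv, (c.coe_toDom (hB v).2.2.1.2.1).symm⟩
    · rintro ⟨v, hv, hvy⟩
      exact ⟨v, hv, Subtype.ext ((c.coe_toDom (hB v).2.2.1.2.1).trans hvy)⟩
  let e : OrbifoldChart n X := linearChart (c.isotropyRep x)
    (fun v => c.proj (c.toDom (P.symm (β v))))
    (fun g v => by simp only [hFe, c.proj_toDom_act])
    (fun u v huv => by
      -- Points of the small chart over the same point of `X` differ by some `g` in the full group;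
      -- since both lie in `N₁`, `g` fixes `x`, so the isotropy group suffices as group of the new
      -- chart.
      obtain ⟨g, hg⟩ := c.proj_eq_iff.1 huv
      have hgx : g • x = x := by
        refine hN₁s g _ (hB u).2.2.1.2.2 ?_
        rw [hg]
        exact (hB v).2.2.1.2.2
      refine ⟨⟨g, hgx⟩, ?_⟩
      rw [← hFl (c.isotropyRep x ⟨g, hgx⟩ u), hFe, ← hFl v]
      congr 2
      have := congrArg Subtype.val hg
      rwa [← c.toDom_act, c.coe_toDom (c.act_mem _ _), c.coe_toDom (hB v).2.2.1.2.1] at this)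
    hpc hpo
  have hlin : e.IsLinear := ⟨rfl, fun g => ⟨c.isotropyRep x g, fun u => rfl⟩⟩
  have htr : ∀ v, IsTransition e c (P.symm ∘ β) v := fun v =>
    ⟨hFd v, hFu v, Eventually.of_forall fun y => ⟨trivial, (hB y).2.2.1.2.1, by
      rw [e.toDom_of_mem trivial]; rfl⟩⟩
  refine ⟨e, hlin, ⟨fun {g h} hgh => ?_⟩, P.symm ∘ β, fun v => ⟨htr v, (hB v).2.2.1.1⟩, ?_, ?_⟩
  · refine Subtype.ext ((htr 0).act_injective (Eventually.of_forall fun v => ?_))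
    have h1 : c.isotropyRep x g v = c.isotropyRep x h v := congrArg Subtype.val (hgh ⟨v, trivial⟩)
    exact ((hFe g v).symm.trans (by rw [h1])).trans (hFe h v)
  · intro u v huv
    rw [← hFl u, ← hFl v]
    exact congrArg (fun y => κ (P y)) huv
  · rw [Function.comp_apply, hβ0, hsx]

end LinearCharts

/-! ### Gluing manifolds along local homeomorphisms -/

section Gluing

/-- A space covered by compatible local homeomorphisms from manifolds is a manifold, in such a way
that these become local diffeomorphisms. -/
theorem exists_chartedSpace_of_isLocalHomeomorph {E H Y ι : Type*} {M : ι → Type*}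
    [NormedAddCommGroup E] [NormedSpace ℝ E] [TopologicalSpace H] (I : ModelWithCorners ℝ E H)
    {k : ℕ∞ω} [TopologicalSpace Y] [∀ i, TopologicalSpace (M i)] [∀ i, ChartedSpace H (M i)]
    [∀ i, IsManifold I k (M i)] (ψ : ∀ i, M i → Y) (hψ : ∀ i, IsLocalHomeomorph (ψ i))
    (hsurj : ∀ y, ∃ i z, ψ i z = y)
    (hcompat : ∀ i j z z', ψ i z = ψ j z' → ∃ g : M i → M j, ContMDiffAt I I k g z ∧ g z = z' ∧
      ∀ᶠ w in 𝓝 z, ψ j (g w) = ψ i w) :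
    ∃ _ : ChartedSpace H Y, IsManifold I k Y ∧ ∀ i, IsLocalDiffeomorph I I k (ψ i) := by
  choose i z hz using hsurj
  choose P hP hPψ using fun y => hψ (i y) (z y)
  -- The charts are local inverses of the `ψ i` followed by charts of `M i`.
  let _ : ChartedSpace H Y :=
    { atlas := {e | ∃ (i : ι) (P : OpenPartialHomeomorph (M i) Y) (z : M i), ψ i = P ∧
        e = P.symm ≫ₕ chartAt H z}
      chartAt := fun y => (P y).symm ≫ₕ chartAt H (z y)
      mem_chart_source := fun y => by
        have h1 : P y (z y) = y := by rw [← hPψ, hz]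
        rw [OpenPartialHomeomorph.trans_source, OpenPartialHomeomorph.symm_source]
        have h2 : y ∈ (P y).target := by
          have := (P y).map_source (hP y)
          rwa [h1] at this
        have h3 : (P y).symm y = z y := ((P y).eq_symm_apply (hP y) h2).2 h1 |>.symm
        refine ⟨h2, ?_⟩
        rw [mem_preimage, h3]
        exact mem_chart_source H (z y)
      chart_mem_atlas := fun y => ⟨_, P y, z y, hPψ y, rfl⟩ }
  have htrans : ∀ {i j : ι} (P : OpenPartialHomeomorph (M i) Y) (P' : OpenPartialHomeomorph (M j) Y),
      ψ i = P → ψ j = P' → ContMDiffOn I I k (P ≫ₕ P'.symm) (P ≫ₕ P'.symm).source := by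
    intro i j P P' hP hP' w hw
    rw [OpenPartialHomeomorph.trans_source] at hw
    have hw2 : P w ∈ P'.target := hw.2
    -- Near `w`, the coordinate change is the regular map `g`: both lift `ψ i` through `ψ j` with
    -- the same value at `w`, and `ψ j` is injective on `P'.source`.
    obtain ⟨g, hg, hgw, hge⟩ := hcompat i j w (P'.symm (P w)) (by
      rw [hP, hP', P'.right_inv hw2])
    refine (hg.congr_of_eventuallyEq ?_).contMDiffWithinAt
    have h1 : ∀ᶠ v in 𝓝 w, g v ∈ P'.source := hg.continuousAt.eventually
      (hgw ▸ P'.open_source.mem_nhds (P'.map_target hw2))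
    filter_upwards [h1, hge] with v hv hv2
    rw [hP, hP'] at hv2
    rw [OpenPartialHomeomorph.coe_trans, Function.comp_apply, ← hv2, P'.left_inv hv]
  have hman : IsManifold I k Y := by
    refine isManifold_of_contDiffOn I k Y ?_
    rintro _ _ ⟨i, P, z, hP, rfl⟩ ⟨j, P', z', hP', rfl⟩
    rw [← contMDiffOn_iff_contDiffOn]
    refine I.contMDiff.comp_contMDiffOn ?_
    have h1 := contMDiffOn_chart (I := I) (n := k) (x := z')
    have h2 := contMDiffOn_chart_symm (I := I) (n := k) (x := z)
    refine h1.comp ((htrans P P' hP hP').comp (h2.comp (I.contMDiffOn_symm.mono (by simp)) ?_) ?_) ?_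
    · intro x hx
      simp only [mfld_simps] at hx ⊢
      tauto
    · intro x hx
      simp only [mfld_simps] at hx ⊢
      tauto
    · intro x hx
      simp only [mfld_simps] at hx ⊢
      tauto
  refine ⟨inferInstance, hman, fun i z => ?_⟩
  obtain ⟨P, hz, hP⟩ := hψ i z
  have hmem : ∀ w, P.symm ≫ₕ chartAt H w ∈ IsManifold.maximalAtlas I k Y := fun w =>
    IsManifold.subset_maximalAtlas ⟨i, P, w, hP, rfl⟩
  refine ⟨⟨P.toPartialEquiv, P.open_source, P.open_target, fun w hw => ?_, fun y hy => ?_⟩, hz,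
    fun w _ => congrFun hP w⟩
  · have h1 : ContMDiffAt I I k ((P.symm ≫ₕ chartAt H w).symm ∘ chartAt H w) w := by
      refine (contMDiffAt_symm_of_mem_maximalAtlas (hmem w) ?_).comp w
        (contMDiffOn_chart.contMDiffAt (chart_source_mem_nhds H w))
      simp only [mfld_simps]
      exact hw
    refine (h1.congr_of_eventuallyEq ?_).contMDiffWithinAt
    filter_upwards [chart_source_mem_nhds H w] with v hv
    simp only [mfld_simps, (chartAt H w).left_inv hv]
  · have hy' : P.symm y ∈ P.source := P.map_target hy
    have h1 : ContMDiffAt I I k ((chartAt H (P.symm y)).symm ∘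
        (P.symm ≫ₕ chartAt H (P.symm y))) y := by
      refine ContMDiffAt.comp y (contMDiffOn_chart_symm.contMDiffAt
        ((chartAt H _).open_target.mem_nhds (mem_chart_target H (P.symm y))))
        (contMDiffAt_of_mem_maximalAtlas (hmem _) ?_)
      simp only [mfld_simps]
      exact hy
    refine (h1.congr_of_eventuallyEq ?_).contMDiffWithinAt
    have h2 : ∀ᶠ v in 𝓝 y, P.symm v ∈ (chartAt H (P.symm y)).source :=
      (P.symm.continuousAt hy).eventually (chart_source_mem_nhds H _)
    filter_upwards [h2] with v hv
    simp only [mfld_simps, (chartAt H _).left_inv hv]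

/-- A space is paracompact if it maps to a paracompact Hausdorff space and is paracompact locally
over it. -/
theorem paracompactSpace_of_locally {X Y : Type*} [TopologicalSpace X] [TopologicalSpace Y]
    [T2Space X] [ParacompactSpace X] {p : Y → X} (hp : Continuous p)
    (h : ∀ x, ∃ U : Set X, IsOpen U ∧ x ∈ U ∧ ParacompactSpace (p ⁻¹' U)) :
    ParacompactSpace Y := by
  choose U hUo hxU hU using h
  -- A locally finite refinement `V` of `U` and a shrinking `W` with closures inside `V`: the given
  -- cover is refined inside each `p ⁻¹' U x` and the pieces are cut off to `p ⁻¹' W x`.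
  obtain ⟨V, hVo, hVc, hVf, hVU⟩ := precise_refinement (u := U) hUo
    (eq_univ_of_forall fun x => mem_iUnion.2 ⟨x, hxU x⟩)
  obtain ⟨W, hWc, hWo, hWV⟩ := exists_iUnion_eq_closure_subset hVo hVf.point_finite hVc
  refine ⟨fun α s hso hsc => ?_⟩
  have hloc : ∀ x, ∃ t : α → Set (p ⁻¹' U x), (∀ a, IsOpen (t a)) ∧ (⋃ a, t a = univ) ∧
      LocallyFinite t ∧ ∀ a, t a ⊆ Subtype.val ⁻¹' s a := fun x =>
    precise_refinement (u := fun a => (Subtype.val ⁻¹' s a : Set (p ⁻¹' U x)))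
      (fun a => (hso a).preimage continuous_subtype_val) (by
        rw [← preimage_iUnion, hsc, preimage_univ])
  choose t hto htc htf hts using hloc
  have hUp : ∀ x, IsOpen (p ⁻¹' U x) := fun x => (hUo x).preimage hp
  have hlf : LocallyFinite fun b : X × α => Subtype.val '' t b.1 b.2 ∩ p ⁻¹' W b.1 := by
    intro y
    obtain ⟨N, hN, hNf⟩ := hVf (p y)
    have hx : ∀ x, ∃ M ∈ 𝓝 y, {a | (Subtype.val '' t x a ∩ p ⁻¹' W x ∩ M).Nonempty}.Finite := by
      intro x
      -- Over the closure of `W x` the point lies in `p ⁻¹' U x`, where `t x` is locally finite;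
      -- elsewhere a neighbourhood misses all the pieces indexed by `x`.
      by_cases hy : p y ∈ closure (W x)
      · have hyU : y ∈ p ⁻¹' U x := hVU x (hWV x hy)
        obtain ⟨M, hM, hMf⟩ := htf x ⟨y, hyU⟩
        refine ⟨Subtype.val '' M, (hUp x).isOpenMap_subtype_val.image_mem_nhds hM,
          hMf.subset ?_⟩
        rintro a ⟨_, ⟨⟨u, hu, rfl⟩, -⟩, ⟨v, hv, huv⟩⟩
        exact ⟨u, hu, Subtype.ext huv ▸ hv⟩
      · refine ⟨p ⁻¹' (closure (W x))ᶜ,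
          hp.continuousAt.preimage_mem_nhds (isClosed_closure.isOpen_compl.mem_nhds hy), ?_⟩
        convert finite_empty
        refine eq_empty_of_forall_notMem fun a => ?_
        rintro ⟨u, ⟨-, hu⟩, hu'⟩
        exact hu' (subset_closure hu)
    choose M hM hMf using hx
    refine ⟨p ⁻¹' N ∩ ⋂ x ∈ {x | (V x ∩ N).Nonempty}, M x,
      inter_mem (hp.continuousAt.preimage_mem_nhds hN) ((biInter_mem hNf).2 fun x _ => hM x), ?_⟩
    refine (hNf.biUnion (t := fun x => Prod.mk x ''
      {a | (Subtype.val '' t x a ∩ p ⁻¹' W x ∩ M x).Nonempty})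
        fun x _ => (hMf x).image _).subset ?_
    rintro ⟨x, a⟩ ⟨u, ⟨hu1, hu2⟩, hu3, hu4⟩
    have hxV : (V x ∩ N).Nonempty := ⟨p u, hWV x (subset_closure hu2), hu3⟩
    exact mem_biUnion hxV ⟨a, ⟨u, ⟨hu1, hu2⟩, mem_iInter₂.1 hu4 x hxV⟩, rfl⟩
  refine ⟨α, fun a => ⋃ x, Subtype.val '' t x a ∩ p ⁻¹' W x, ?_, ?_, ?_, ?_⟩
  · exact fun a => isOpen_iUnion fun x =>
      ((hUp x).isOpenMap_subtype_val _ (hto x a)).inter ((hWo x).preimage hp)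
  · refine eq_univ_of_forall fun y => ?_
    obtain ⟨x, hx⟩ := mem_iUnion.1 (hWc ▸ mem_univ (p y) : p y ∈ ⋃ x, W x)
    have hy : y ∈ p ⁻¹' U x := hVU x (hWV x (subset_closure hx))
    obtain ⟨a, ha⟩ := mem_iUnion.1 (htc x ▸ mem_univ (⟨y, hy⟩ : p ⁻¹' U x) : _ ∈ ⋃ a, t x a)
    exact mem_iUnion.2 ⟨a, mem_iUnion.2 ⟨x, ⟨_, ha, rfl⟩, hx⟩⟩
  · intro y
    obtain ⟨N, hN, hNf⟩ := hlf y
    refine ⟨N, hN, (hNf.image Prod.snd).subset ?_⟩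
    rintro a ⟨u, hu, huN⟩
    obtain ⟨x, hx⟩ := mem_iUnion.1 hu
    exact ⟨(x, a), ⟨u, hx, huN⟩, rfl⟩
  · refine fun a => ⟨a, iUnion_subset fun x => inter_subset_left.trans ?_⟩
    rintro _ ⟨u, hu, rfl⟩
    exact hts x a hu

end Gluing

/-! ### Lifting transition maps to frames -/

section LiftFrame

variable {n : ℕ} {X : Type*} [TopologicalSpace X]

/-- A retraction of the endomorphisms of `ℝⁿ` onto the invertible ones, with an arbitrary value at
the others. -/
noncomputable def toGL : EndEuc n → GLn n :=
  (Units.isOpenEmbedding_val.toOpenPartialHomeomorph (Units.val : GLn n → EndEuc n)).symm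

@[simp] theorem toGL_coe (A : GLn n) : toGL (A : EndEuc n) = A :=
  (Units.isOpenEmbedding_val.toOpenPartialHomeomorph (Units.val : GLn n → EndEuc n)).left_inv
    trivial

theorem coe_toGL {T : EndEuc n} (hT : IsUnit T) : (toGL T : EndEuc n) = T := by
  obtain ⟨u, rfl⟩ := hT
  rw [toGL_coe]

theorem contMDiffAt_toGL {T : EndEuc n} (hT : IsUnit T) :
    ContMDiffAt (modelGL n) (modelGL n) ω (toGL : EndEuc n → GLn n) T :=
  (contMDiffOn_isOpenEmbedding_symm (I := modelGL n) (n := ω)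
    (Units.isOpenEmbedding_val (R := EndEuc n))).contMDiffAt
    (Units.isOpenEmbedding_val.isOpen_range.mem_nhds hT)

/-- The map of frames induced by a local diffeomorphism, with values in the frames on the domain of
a chart. -/
noncomputable def OrbifoldChart.liftFrame (d : OrbifoldChart n X) (f : Euc n → Euc n)
    {U : Opens (Euc n)} (z : Frame U) : Frame d.dom :=
  (d.toDom (f z.1), toGL (fderiv ℝ f z.1 * z.2))

variable {c d k : OrbifoldChart n X}

theorem IsTransition.coe_liftFrame_fst {f : Euc n → Euc n} {z : Frame c.dom}
    (h : IsTransition c d f z.1) : ((d.liftFrame f z).1 : Euc n) = f z.1 :=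
  d.coe_toDom h.map_mem

theorem IsTransition.coe_liftFrame_snd {f : Euc n → Euc n} {z : Frame c.dom}
    (h : IsTransition c d f z.1) : ((d.liftFrame f z).2 : EndEuc n) = fderiv ℝ f z.1 * z.2 :=
  coe_toGL (h.isUnit.mul z.2.isUnit)

theorem frame_ext {U : Opens (Euc n)} {z z' : Frame U} (h1 : (z.1 : Euc n) = z'.1)
    (h2 : (z.2 : EndEuc n) = z'.2) : z = z' :=
  Prod.ext (Subtype.ext h1) (Units.ext h2)

theorem OrbifoldChart.liftFrame_congr {f g : Euc n → Euc n} {z : Frame c.dom}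
    (h : f =ᶠ[𝓝 (z.1 : Euc n)] g) : d.liftFrame f z = d.liftFrame g z := by
  rw [OrbifoldChart.liftFrame, h.eq_of_nhds, h.fderiv_eq]
  rfl

theorem IsTransition.liftFrame_comp {f g : Euc n → Euc n} {z : Frame c.dom}
    (hf : IsTransition c d f z.1) (hg : IsTransition d k g (f z.1)) :
    k.liftFrame (g ∘ f) z = k.liftFrame g (d.liftFrame f z) := by
  have hg' : IsTransition d k g (d.liftFrame f z).1 := by rwa [hf.coe_liftFrame_fst]
  refine frame_ext ?_ ?_
  · rw [(hg.comp hf).coe_liftFrame_fst, hg'.coe_liftFrame_fst, hf.coe_liftFrame_fst]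
    rfl
  · rw [(hg.comp hf).coe_liftFrame_snd, hg'.coe_liftFrame_snd, hf.coe_liftFrame_snd,
      hf.coe_liftFrame_fst, hg.fderiv_comp hf, mul_assoc]

theorem OrbifoldChart.liftFrame_id (z : Frame c.dom) : c.liftFrame id z = z := by
  refine frame_ext ?_ ?_
  · rw [(IsTransition.id c z.1.2).coe_liftFrame_fst, id]
  · rw [(IsTransition.id c z.1.2).coe_liftFrame_snd, fderiv_id]
    rfl

theorem OrbifoldChart.liftFrame_act (g : c.G) (z : Frame c.dom) :
    c.liftFrame (c.act g) z = g • z := by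
  refine frame_ext ?_ ?_
  · rw [(IsTransition.act c g z.1.2).coe_liftFrame_fst, c.act_coe]
    rfl
  · rw [(IsTransition.act c g z.1.2).coe_liftFrame_snd, OrbifoldChart.act,
      ← c.jac_eq_fderiv (c.analytic_smul g)]
    rfl

theorem ChartEmbedding.liftFrame_ext (e : ChartEmbedding c d) (z : Frame c.dom) :
    d.liftFrame (c.ext e.map) z = e.frameMap z := by
  refine frame_ext ?_ ?_
  · rw [(e.isTransition z.1.2).coe_liftFrame_fst, c.ext_coe]
    rfl
  · rw [(e.isTransition z.1.2).coe_liftFrame_snd, ← c.jac_eq_fderiv e.analytic]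
    rfl

theorem IsTransition.contMDiffAt_liftFrame {f : Euc n → Euc n} {z : Frame c.dom}
    (h : IsTransition c d f z.1) :
    ContMDiffAt (modelFrame n) (modelFrame n) ω
      (fun z : Frame c.dom => d.liftFrame f z) z := by
  have h1 : ContMDiffAt (modelFrame n) (modelEuc n) ω (fun z : Frame c.dom => (z.1 : Euc n)) z :=
    (contMDiff_subtype_val.comp contMDiff_fst) z
  have h2 : ContMDiffAt (modelFrame n) (modelGL n) ω
      (fun z : Frame c.dom => (z.2 : EndEuc n)) z :=
    (Units.contMDiff_val.comp contMDiff_snd) z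
  refine ContMDiffAt.prodMk ?_ ?_
  · exact ((d.contMDiffAt_toDom h.map_mem).comp (z.1 : Euc n) h.contDiffAt.contMDiffAt).comp z h1
  · have h3 : ContMDiffAt (modelFrame n) (modelGL n) ω
        (fun z : Frame c.dom => fderiv ℝ f z.1) z :=
      h.contDiffAt_fderiv.contMDiffAt.comp z h1
    refine (contMDiffAt_toGL (h.isUnit.mul z.2.isUnit)).comp z ?_
    exact h3.clm_comp h2

end LiftFrame

/-! ### The frame bundle -/

namespace AnalyticOrbifold

variable {n : ℕ} {X : Type*} [TopologicalSpace X] (O : AnalyticOrbifold n X)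

/-- The element of the frame bundle given by a frame in a chart. -/
noncomputable def frame (c : O.atlas) (z : Frame c.1.dom) : O.FrameBundle :=
  O.ofChart c (c.1.frameClass z)

variable {O}

theorem exists_frame_eq (y : O.FrameBundle) : ∃ c z, O.frame c z = y := by
  induction y using Quot.ind with
  | mk p =>
    obtain ⟨c, q⟩ := p
    induction q using Quotient.inductionOn with
    | h z => exact ⟨c, z, rfl⟩

theorem frameBundleProj_frame (c : O.atlas) (z : Frame c.1.dom) :
    O.frameBundleProj (O.frame c z) = c.1.proj z.1 := rfl

theorem smul_frame (A : GLn n) (c : O.atlas) (z : Frame c.1.dom) :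
    A • O.frame c z = O.frame c (frameMulInv A z) := rfl

theorem frame_smul (c : O.atlas) (g : c.1.G) (z : Frame c.1.dom) :
    O.frame c (g • z) = O.frame c z :=
  congrArg (O.ofChart c) (c.1.frameClass_smul g z)

theorem frame_frameMap (c d : O.atlas) (e : ChartEmbedding c.1 d.1) (z : Frame c.1.dom) :
    O.frame d (e.frameMap z) = O.frame c z :=
  (Quot.sound (.glue c d e (c.1.frameClass z))).symm

/-- By rigidity `f` is the embedding followed by a group element, which is invisible in `Fr(Ṽ)/H`.
-/
theorem frame_liftFrame_of_embedding (c d : O.atlas) (e : ChartEmbedding c.1 d.1)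
    {f : Euc n → Euc n} {z : Frame c.1.dom} (hf : IsTransition c.1 d.1 f z.1) :
    O.frame d (d.1.liftFrame f z) = O.frame c z := by
  obtain ⟨g, hg⟩ := (e.isTransition z.1.2).exists_eventuallyEq_act hf
  rw [OrbifoldChart.liftFrame_congr hg, (e.isTransition z.1.2).liftFrame_comp
    (.act _ _ (e.isTransition z.1.2).map_mem), OrbifoldChart.liftFrame_act, frame_smul,
    e.liftFrame_ext, frame_frameMap]

/-- An arbitrary transition map need not come from an embedding, but it factors through a chart `k`
embedded in both `c` and `d`. If `s` is a transition map from `k` to `c`, then `s` and `f ∘ s` are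
both covered by the preceding case. -/
theorem frame_liftFrame {c d : O.atlas} {f : Euc n → Euc n} {z : Frame c.1.dom}
    (hf : IsTransition c.1 d.1 f z.1) : O.frame d (d.1.liftFrame f z) = O.frame c z := by
  obtain ⟨k, hk, ⟨w, hw⟩, ⟨a⟩, ⟨b⟩⟩ := O.isAtlas.compat c c.2 d d.2 (c.1.proj z.1)
    ⟨mem_range_self _, by
      have := hf.proj_eq
      rw [c.1.toDom_coe] at this
      exact this ▸ mem_range_self _⟩
  obtain ⟨h, hh, -⟩ := O.exists_isTransition c.2 hk z.1.2 w.2 (by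
    rw [c.1.toDom_coe, k.toDom_coe, hw])
  obtain ⟨s, hs, hsx, hse⟩ := hh.symm
  have hs' : IsTransition k c.1 s (k.liftFrame h z).1 := by rwa [hh.coe_liftFrame_fst]
  have h1 : c.1.liftFrame s (k.liftFrame h z) = z := by
    rw [← hh.liftFrame_comp hs, OrbifoldChart.liftFrame_congr hse,
      OrbifoldChart.liftFrame_id]
  have hfs : IsTransition c.1 d.1 f (s (k.liftFrame h z).1) := by
    rwa [hh.coe_liftFrame_fst, hsx]
  have h2 := frame_liftFrame_of_embedding ⟨k, hk⟩ c a hs'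
  have h3 := frame_liftFrame_of_embedding ⟨k, hk⟩ d b (hfs.comp hs')
  rw [hs'.liftFrame_comp hfs, h1] at h3
  rw [h1] at h2
  rw [h2, h3]

/-- Being the lift of `z` by a transition map is a property of frames that is invariant under chart
groups and under gluing, in both directions. It therefore descends to a predicate on the colimit,
and it holds at `z` itself. No chain of generating identifications has to be analysed. -/
theorem exists_liftFrame_eq {c d : O.atlas} {z : Frame c.1.dom} {z' : Frame d.1.dom}
    (h : O.frame c z = O.frame d z') :
    ∃ f, IsTransition c.1 d.1 f z.1 ∧ d.1.liftFrame f z = z' := by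
  let L : O.FrameBundle → Prop := Quot.lift
    (fun p => Quotient.lift
      (fun w : Frame p.1.1.dom => ∃ f, IsTransition c.1 p.1.1 f z.1 ∧ p.1.1.liftFrame f z = w) (by
        rintro _ w ⟨g, rfl⟩
        refine propext ⟨?_, ?_⟩
        · rintro ⟨f, hf, hfw⟩
          refine ⟨p.1.1.act g⁻¹ ∘ f, IsTransition.comp (.act _ _ hf.map_mem) hf, ?_⟩
          rw [hf.liftFrame_comp (.act _ _ hf.map_mem), hfw, OrbifoldChart.liftFrame_act]
          exact inv_smul_smul g w
        · rintro ⟨f, hf, hfw⟩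
          refine ⟨p.1.1.act g ∘ f, IsTransition.comp (.act _ _ hf.map_mem) hf, ?_⟩
          rw [hf.liftFrame_comp (.act _ _ hf.map_mem), hfw, OrbifoldChart.liftFrame_act]) p.2) (by
      rintro _ _ ⟨a, b, e, q⟩
      induction q using Quotient.inductionOn with
      | h w =>
        change (∃ f, IsTransition c.1 a.1 f z.1 ∧ a.1.liftFrame f z = w) =
          (∃ f, IsTransition c.1 b.1 f z.1 ∧ b.1.liftFrame f z = e.frameMap w)
        refine propext ⟨?_, ?_⟩
        · rintro ⟨f, hf, rfl⟩
          have he := e.isTransition hf.map_mem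
          exact ⟨_, he.comp hf, by rw [hf.liftFrame_comp he, e.liftFrame_ext]⟩
        · rintro ⟨f, hf, hfw⟩
          have he := e.isTransition w.1.2
          obtain ⟨s, hs, hsx, hse⟩ := he.symm
          have hew : f z.1 = a.1.ext e.map w.1 := by
            rw [← hf.coe_liftFrame_fst, hfw, a.1.ext_coe]
            rfl
          rw [← hew] at hs
          refine ⟨_, hs.comp hf, ?_⟩
          rw [hf.liftFrame_comp hs, hfw, ← e.liftFrame_ext, ← he.liftFrame_comp (hew ▸ hs),
            OrbifoldChart.liftFrame_congr hse, OrbifoldChart.liftFrame_id])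
  have h1 : L (O.frame c z) := ⟨id, .id _ z.1.2, OrbifoldChart.liftFrame_id z⟩
  rw [h] at h1
  exact h1

/-- A transition map from a chart to itself is, near its base point, given by a group element:
compare it with the identity. -/
theorem frame_eq_frame_iff {c : O.atlas} {z z' : Frame c.1.dom} :
    O.frame c z = O.frame c z' ↔ ∃ g : c.1.G, g • z = z' := by
  constructor
  · intro h
    obtain ⟨f, hf, rfl⟩ := exists_liftFrame_eq h
    obtain ⟨g, hg⟩ := (IsTransition.id c.1 z.1.2).exists_eventuallyEq_act hf
    refine ⟨g, ?_⟩
    rw [OrbifoldChart.liftFrame_congr hg, ← OrbifoldChart.liftFrame_act]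
    rfl
  · rintro ⟨g, rfl⟩
    exact (frame_smul c g z).symm

theorem injective_ofChart (c : O.atlas) : Function.Injective (O.ofChart c) := by
  intro a b
  induction a using Quotient.inductionOn with | h a => ?_
  induction b using Quotient.inductionOn with | h b => ?_
  intro h
  obtain ⟨g, rfl⟩ := frame_eq_frame_iff.1 (show O.frame c a = O.frame c b from h)
  exact (c.1.frameClass_smul g a).symm

theorem continuous_ofChart (c : O.atlas) : Continuous (O.ofChart c) :=
  continuous_quot_mk.comp continuous_sigmaMk

theorem continuous_frame (c : O.atlas) : Continuous (O.frame c) :=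
  (continuous_ofChart c).comp continuous_quotient_mk'

/-- In the colimit topology, openness is tested in every chart `d`. There, a transition map to `c`
lifts to a continuous map of frames that does not change the point of `Fr(X)`, so a neighbourhood
stays in the image of `S`. -/
theorem isOpenMap_frame (c : O.atlas) : IsOpenMap (O.frame c) := by
  intro S hS
  refine isOpen_coinduced.2 (isOpen_sigma_iff.2 fun d =>
    isOpen_coinduced.2 (isOpen_iff_mem_nhds.2 ?_))
  rintro w ⟨z, hz, hzw⟩
  obtain ⟨f, hf, hfz⟩ := exists_liftFrame_eq (c := d) (z := w) (d := c) (z' := z) hzw.symm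
  subst hfz
  have h1 : ∀ᶠ v : Frame d.1.dom in 𝓝 w, c.1.liftFrame f v ∈ S :=
    hf.contMDiffAt_liftFrame.continuousAt.eventually (hS.mem_nhds hz)
  have h2 : ∀ᶠ v : Frame d.1.dom in 𝓝 w, IsTransition d.1 c.1 f v.1 :=
    (continuous_subtype_val.comp continuous_fst).continuousAt.eventually hf.eventually
  filter_upwards [h1, h2] with v hv1 hv2
  exact ⟨_, hv1, frame_liftFrame hv2⟩

theorem isOpenEmbedding_ofChart (c : O.atlas) : IsOpenEmbedding (O.ofChart c) := by
  refine .of_continuous_injective_isOpenMap (continuous_ofChart c) (injective_ofChart c) ?_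
  intro W hW
  convert isOpenMap_frame c _ (hW.preimage continuous_quotient_mk') using 1
  ext y
  constructor
  · rintro ⟨q, hq, rfl⟩
    induction q using Quotient.inductionOn with | h z => ?_
    exact ⟨z, hq, rfl⟩
  · rintro ⟨z, hz, rfl⟩
    exact ⟨_, hz, rfl⟩

end AnalyticOrbifold

instance OrbifoldChart.continuousConstSMul_frame {n : ℕ} {X : Type*} [TopologicalSpace X]
    (c : OrbifoldChart n X) : ContinuousConstSMul c.G (Frame c.dom) where
  continuous_const_smul g := by
    refine continuous_iff_continuousAt.2 fun z => ?_
    have := (IsTransition.act c g z.1.2).contMDiffAt_liftFrame.continuousAt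
    simpa only [OrbifoldChart.liftFrame_act] using this

namespace AnalyticOrbifold

variable {n : ℕ} {X : Type*} [TopologicalSpace X] {O : AnalyticOrbifold n X}

/-- The map is continuous and open, and freeness of the finite group action on frames makes it
injective near every point. -/
theorem isLocalHomeomorph_frame (hO : O.IsReduced) (c : O.atlas) :
    IsLocalHomeomorph (O.frame c) := by
  have := hO c.1 c.2
  refine IsLocalHomeomorph.mk _ fun z => ?_
  obtain ⟨N, hN, hNz⟩ := exists_nhds_smul_eq_of_mem (G := c.1.G) z
  obtain ⟨S, hSN, hS, hzS⟩ := mem_nhds_iff.1 hN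
  have hinj : InjOn (O.frame c) S := by
    intro a ha b hb hab
    obtain ⟨g, rfl⟩ := frame_eq_frame_iff.1 hab
    have := c.1.frame_smul_eq_self_iff.1 (hNz g a (hSN ha) (hSN hb))
    rw [this, one_smul]
  have : Nonempty (Frame c.1.dom) := ⟨z⟩
  refine ⟨OpenPartialHomeomorph.ofContinuousOpen hinj.toPartialEquiv
    (continuous_frame c).continuousOn (isOpenMap_frame c) hS, hzS, fun y _ => rfl⟩

theorem exists_chartedSpace_frameBundle (hO : O.IsReduced) :
    ∃ _ : ChartedSpace (FrameModelSpace n) O.FrameBundle,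
      IsManifold (modelFrame n) ω O.FrameBundle ∧
      ∀ c : O.atlas, IsLocalDiffeomorph (modelFrame n) (modelFrame n) ω (O.frame c) := by
  refine exists_chartedSpace_of_isLocalHomeomorph (modelFrame n)
    (M := fun c : O.atlas => Frame c.1.dom) O.frame
    (isLocalHomeomorph_frame hO) exists_frame_eq fun c d z z' h => ?_
  obtain ⟨f, hf, hfz⟩ := exists_liftFrame_eq h
  refine ⟨fun z => d.1.liftFrame f z, hf.contMDiffAt_liftFrame, hfz, ?_⟩
  have h2 : ∀ᶠ v : Frame c.1.dom in 𝓝 z, IsTransition c.1 d.1 f v.1 :=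
    (continuous_subtype_val.comp continuous_fst).continuousAt.eventually hf.eventually
  filter_upwards [h2] with v hv
  exact frame_liftFrame hv

end AnalyticOrbifold

/-! ### Topology of the frame bundle -/

section Topology

variable {n : ℕ} {X : Type*} [TopologicalSpace X]

instance instLocallyCompactSpaceGLn (n : ℕ) : LocallyCompactSpace (GLn n) :=
  Units.isOpenEmbedding_val.locallyCompactSpace

instance instSecondCountableTopologyGLn (n : ℕ) : SecondCountableTopology (GLn n) :=
  Units.isOpenEmbedding_val.isEmbedding.secondCountableTopology

instance instLocallyCompactSpaceOpens {n : ℕ} (U : Opens (Euc n)) : LocallyCompactSpace U :=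
  U.isOpen.locallyCompactSpace

theorem OrbifoldChart.continuous_frameProj (c : OrbifoldChart n X) : Continuous c.frameProj :=
  (c.continuous_proj.comp continuous_fst).quotient_lift _

theorem OrbifoldChart.t2Space_frameQuotient (c : OrbifoldChart n X) :
    T2Space c.FrameQuotient :=
  inferInstanceAs (T2Space (Quotient (MulAction.orbitRel c.G (Frame c.dom))))

theorem OrbifoldChart.paracompactSpace_frameQuotient (c : OrbifoldChart n X) :
    ParacompactSpace c.FrameQuotient := by
  have := c.t2Space_frameQuotient
  have : LocallyCompactSpace c.FrameQuotient :=
    (MulAction.isOpenQuotientMap_quotientMk (Γ := c.G) (T := Frame c.dom)).locallyCompactSpace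
  have : SecondCountableTopology c.FrameQuotient :=
    ContinuousConstSMul.secondCountableTopology (Γ := c.G) (T := Frame c.dom)
  infer_instance

/-- In a reduced chart, there are points with trivial isotropy in every nonempty open set. -/
theorem OrbifoldChart.exists_forall_smul_eq_imp (c : OrbifoldChart n X) [FaithfulSMul c.G c.dom]
    {U : Set c.dom} (hU : IsOpen U) (hne : U.Nonempty) :
    ∃ w ∈ U, ∀ g : c.G, g • w = w → g = 1 := by
  -- Take `w` with isotropy of least order. Isotropy groups of nearby points are contained in that
  -- of `w`, hence equal to it, so an element fixing `w` fixes a neighbourhood and is trivial.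
  obtain ⟨w, hw, hmin⟩ := exists_minimalFor_of_wellFoundedLT (· ∈ U)
    (fun w : c.dom => Nat.card (MulAction.stabilizer c.G w)) hne
  refine ⟨w, hw, fun g hg => ?_⟩
  obtain ⟨N, hN, hNw⟩ := exists_nhds_smul_eq_of_mem (G := c.G) w
  refine c.eq_one_of_act_eventuallyEq w.2 ?_
  have h1 : ∀ᶠ y in 𝓝 w, g • y = y := by
    filter_upwards [hN, hU.mem_nhds hw] with y hyN hyU
    have hle : MulAction.stabilizer c.G y ≤ MulAction.stabilizer c.G w := fun h hh =>
      hNw h y hyN (by rw [MulAction.mem_stabilizer_iff.1 hh]; exact hyN)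
    have heq := Subgroup.eq_of_le_of_card_ge hle (hmin hyU (Subgroup.card_le_of_le hle))
    exact MulAction.mem_stabilizer_iff.1 (heq ▸ MulAction.mem_stabilizer_iff.2 hg)
  have h2 := (c.continuousAt_toDom w.2).eventually (by rwa [c.toDom_coe])
  filter_upwards [h2, c.isOpen_dom.mem_nhds w.2] with y hy hyd
  rw [OrbifoldChart.act, OrbifoldChart.ext, hy, c.coe_toDom hyd, id]

namespace AnalyticOrbifold

variable {O : AnalyticOrbifold n X}

theorem continuous_frameBundleProj : Continuous (O.frameBundleProj : O.FrameBundle → X) := by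
  have h : Continuous fun p : Σ c : O.atlas, c.1.FrameQuotient => p.1.1.frameProj p.2 :=
    continuous_sigma fun c => c.1.continuous_frameProj
  exact continuous_coinduced_dom.2 h

theorem frameBundleProj_smul (A : GLn n) (y : O.FrameBundle) :
    O.frameBundleProj (A • y) = O.frameBundleProj y := by
  obtain ⟨c, z, rfl⟩ := exists_frame_eq y
  rfl

/-- A transition map to `c` with value `x` carries a frame from any other chart to a frame at `x`:
all points of the fibre are visible at one chosen lift of the base point. -/
theorem exists_frame_eq_of_proj_eq (c : O.atlas) (x : c.1.dom) {y : O.FrameBundle}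
    (h : O.frameBundleProj y = c.1.proj x) : ∃ B : GLn n, O.frame c (x, B) = y := by
  obtain ⟨d, z, rfl⟩ := exists_frame_eq y
  obtain ⟨f, hf, hfx⟩ := O.exists_isTransition d.2 c.2 z.1.2 x.2 (by
    rw [d.1.toDom_coe, c.1.toDom_coe]; exact h)
  refine ⟨(c.1.liftFrame f z).2, ?_⟩
  rw [← frame_liftFrame hf]
  congr 1
  exact frame_ext (by rw [hf.coe_liftFrame_fst, hfx]) rfl

theorem range_ofChart (c : O.atlas) :
    range (O.ofChart c) = O.frameBundleProj ⁻¹' range c.1.proj := by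
  ext y
  constructor
  · rintro ⟨q, rfl⟩
    induction q using Quotient.inductionOn with | h z => ?_
    exact ⟨z.1, rfl⟩
  · rintro ⟨x, hx⟩
    obtain ⟨B, rfl⟩ := exists_frame_eq_of_proj_eq c x hx.symm
    exact ⟨_, rfl⟩

theorem exists_mem_range_proj (x : X) : ∃ c : O.atlas, ∃ w, c.1.proj w = x := by
  obtain ⟨c, hc, w, hw⟩ := O.isAtlas.cover x
  exact ⟨⟨c, hc⟩, w, hw⟩

/-- Points in different fibres are separated in `X`. Points in the same fibre lie in one open piece
`Fr(Ũ)/G`, which is Hausdorff as a quotient by a finite group. -/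
theorem t2Space_frameBundle : T2Space O.FrameBundle := by
  refine ⟨fun y y' hne => ?_⟩
  have := O.t2Space
  by_cases h : O.frameBundleProj y = O.frameBundleProj y'
  · obtain ⟨c, x, hx⟩ := exists_mem_range_proj (O := O) (O.frameBundleProj y)
    have hy : y ∈ range (O.ofChart c) := by rw [range_ofChart]; exact ⟨x, hx⟩
    have hy' : y' ∈ range (O.ofChart c) := by rw [range_ofChart]; exact ⟨x, hx.trans h⟩
    obtain ⟨q, rfl⟩ := hy
    obtain ⟨q', rfl⟩ := hy'
    have := c.1.t2Space_frameQuotient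
    obtain ⟨U, V, hU, hV, hqU, hqV, hUV⟩ := t2_separation (ne_of_apply_ne _ hne)
    exact ⟨_, _, (isOpenEmbedding_ofChart c).isOpenMap _ hU,
      (isOpenEmbedding_ofChart c).isOpenMap _ hV, mem_image_of_mem _ hqU, mem_image_of_mem _ hqV,
      disjoint_image_of_injective (injective_ofChart c) hUV⟩
  · obtain ⟨U, V, hU, hV, hyU, hyV, hUV⟩ := t2_separation h
    exact ⟨_, _, hU.preimage continuous_frameBundleProj, hV.preimage continuous_frameBundleProj,
      hyU, hyV, hUV.preimage _⟩

theorem paracompactSpace_frameBundle : ParacompactSpace O.FrameBundle := by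
  have := O.t2Space
  have := O.paracompactSpace
  refine paracompactSpace_of_locally (continuous_frameBundleProj (O := O)) fun x => ?_
  obtain ⟨c, w, hw⟩ := exists_mem_range_proj (O := O) x
  refine ⟨range c.1.proj, c.1.isOpen_range_proj, ⟨w, hw⟩, ?_⟩
  rw [← range_ofChart]
  have := c.1.paracompactSpace_frameQuotient
  exact (isOpenEmbedding_ofChart c).toHomeomorph.symm.isClosedEmbedding.paracompactSpace

/-! ### The action of the general linear group -/

/-- If `A` fixes `[x, B]`, then `g (x, B A⁻¹) = (x, B)` for some `g` in the chart group, and `A =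
B⁻¹ (dg)_x B` is determined by `g`. -/
theorem finite_stabilizer (y : O.FrameBundle) : Finite (MulAction.stabilizer (GLn n) y) := by
  obtain ⟨c, z, rfl⟩ := exists_frame_eq y
  refine Set.Finite.to_subtype ((finite_range fun g : c.1.G => z.2⁻¹ * (g • z).2).subset ?_)
  intro A hA
  obtain ⟨g, hg⟩ := frame_eq_frame_iff.1
    (show O.frame c (frameMulInv A z) = O.frame c z from hA)
  rw [← c.1.frameMulInv_smul] at hg
  refine ⟨g, ?_⟩
  change z.2⁻¹ * (g • z).2 = A
  have h2 : (g • z).2 * A⁻¹ = z.2 := congrArg Prod.snd hg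
  rw [inv_mul_eq_iff_eq_mul, ← h2, inv_mul_cancel_right]

/-- A frame over a chart point with trivial isotropy has trivial stabilizer in `GL_n(ℝ)`. -/
theorem faithfulSMul_frameBundle [Nonempty X] (hO : O.IsReduced) :
    FaithfulSMul (GLn n) O.FrameBundle := by
  refine ⟨fun {A B} hAB => ?_⟩
  obtain ⟨c, x, -⟩ := exists_mem_range_proj (O := O) (Classical.arbitrary X)
  have := hO c.1 c.2
  obtain ⟨w, -, hw⟩ := c.1.exists_forall_smul_eq_imp isOpen_univ ⟨x, mem_univ x⟩
  obtain ⟨g, hg⟩ := frame_eq_frame_iff.1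
    (show O.frame c (frameMulInv A (w, 1)) = O.frame c (frameMulInv B (w, 1)) from
      hAB (O.frame c (w, 1)))
  have h1 := hw g (congrArg Prod.fst hg)
  rw [h1, one_smul] at hg
  have h2 : (1 : GLn n) * A⁻¹ = 1 * B⁻¹ := congrArg Prod.snd hg
  rwa [one_mul, one_mul, inv_inj] at h2

theorem contMDiff_frameMulInv (U : Opens (Euc n)) :
    ContMDiff ((modelGL n).prod (modelFrame n)) (modelFrame n) ω
      (fun p : GLn n × Frame U => frameMulInv p.1 p.2) := by
  have h1 : ContMDiff ((modelGL n).prod (modelFrame n)) (modelEuc n) ω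
      (fun p : GLn n × Frame U => p.2.1) := contMDiff_fst.comp contMDiff_snd
  have h2 : ContMDiff ((modelGL n).prod (modelFrame n)) (modelGL n) ω
      (fun p : GLn n × Frame U => p.2.2) := contMDiff_snd.comp contMDiff_snd
  have h3 : ContMDiff ((modelGL n).prod (modelFrame n)) (modelGL n) ω
      (fun p : GLn n × Frame U => p.1⁻¹) := contMDiff_fst.inv
  exact h1.prodMk (h2.mul h3)

theorem contMDiff_smul_frameBundle [ChartedSpace (FrameModelSpace n) O.FrameBundle]
    (hψ : ∀ c : O.atlas, IsLocalDiffeomorph (modelFrame n) (modelFrame n) ω (O.frame c)) :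
    ContMDiff ((modelGL n).prod (modelFrame n)) (modelFrame n) ω
      (fun p : GLn n × O.FrameBundle => p.1 • p.2) := by
  rintro ⟨A, y⟩
  obtain ⟨c, z, rfl⟩ := exists_frame_eq y
  have hz := hψ c z
  have h1 : ContMDiffAt ((modelGL n).prod (modelFrame n)) (modelFrame n) ω
      (fun p : GLn n × O.FrameBundle => hz.localInverse p.2) (A, O.frame c z) :=
    hz.localInverse_contMDiffAt.comp (A, O.frame c z) contMDiffAt_snd
  have h2 := ((hψ c).contMDiff.comp (contMDiff_frameMulInv c.1.dom)).contMDiffAt.comp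
    (A, O.frame c z) (contMDiffAt_fst.prodMk h1)
  refine h2.congr_of_eventuallyEq ?_
  have h3 : ∀ᶠ p : GLn n × O.FrameBundle in 𝓝 (A, O.frame c z),
      O.frame c (hz.localInverse p.2) = p.2 :=
    (continuousAt_snd (p := (A, O.frame c z))).eventually hz.localInverse_eventuallyEq_right
  filter_upwards [h3] with p hp
  change p.1 • p.2 = O.frame c (frameMulInv p.1 (hz.localInverse p.2))
  rw [← smul_frame, hp]

/-- With `A • y → y₁` and `y → y₂` along an ultrafilter, one must show that `A` converges. Since `p`
is invariant, both limits lie in one fibre and have frames over one point of a single chart. In that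
chart `A` is expressed through the two converging frames and an element `g` of a finite group. -/
theorem properSMul_frameBundle [ChartedSpace (FrameModelSpace n) O.FrameBundle]
    (hψ : ∀ c : O.atlas, IsLocalDiffeomorph (modelFrame n) (modelFrame n) ω (O.frame c)) :
    ProperSMul (GLn n) O.FrameBundle := by
  have := t2Space_frameBundle (O := O)
  have := O.t2Space
  refine properSMul_iff_continuousSMul_ultrafilter_tendsto_t2.2
    ⟨⟨(contMDiff_smul_frameBundle hψ).continuous⟩, fun 𝒰 y₁ y₂ hy => ?_⟩
  have t1 : Tendsto (fun p : GLn n × O.FrameBundle => p.1 • p.2) 𝒰 (𝓝 y₁) :=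
    (continuous_fst.tendsto _).comp hy
  have t2 : Tendsto (fun p : GLn n × O.FrameBundle => p.2) 𝒰 (𝓝 y₂) :=
    (continuous_snd.tendsto _).comp hy
  have hp : O.frameBundleProj y₂ = O.frameBundleProj y₁ := by
    refine tendsto_nhds_unique ((continuous_frameBundleProj.tendsto _).comp t2) ?_
    refine ((continuous_frameBundleProj.tendsto _).comp t1).congr fun p => ?_
    exact frameBundleProj_smul p.1 p.2
  obtain ⟨c, z₁, rfl⟩ := exists_frame_eq y₁
  obtain ⟨B, rfl⟩ := exists_frame_eq_of_proj_eq c z₁.1 hp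
  have i₁ := hψ c z₁
  have i₂ := hψ c (z₁.1, B)
  have s₁ : Tendsto (fun p : GLn n × O.FrameBundle => i₁.localInverse (p.1 • p.2)) 𝒰 (𝓝 z₁) := by
    have h := i₁.localInverse_contMDiffAt.continuousAt.tendsto
    rw [i₁.localInverse_left_inv i₁.localInverse_mem_target] at h
    exact h.comp t1
  have s₂ : Tendsto (fun p : GLn n × O.FrameBundle => i₂.localInverse p.2) 𝒰
      (𝓝 (z₁.1, B)) := by
    have h := i₂.localInverse_contMDiffAt.continuousAt.tendsto
    rw [i₂.localInverse_left_inv i₂.localInverse_mem_target] at h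
    exact h.comp t2
  have hex : ∀ᶠ p : GLn n × O.FrameBundle in 𝒰, ∃ g : c.1.G,
      frameMulInv p.1 (i₂.localInverse p.2) = g • i₁.localInverse (p.1 • p.2) := by
    filter_upwards [t1.eventually i₁.localInverse_eventuallyEq_right,
      t2.eventually i₂.localInverse_eventuallyEq_right] with p h1 h2
    have h3 : O.frame c (i₁.localInverse (p.1 • p.2)) =
        O.frame c (frameMulInv p.1 (i₂.localInverse p.2)) := by
      rw [← smul_frame]
      exact h1.trans (congrArg (p.1 • ·) h2.symm)
    obtain ⟨g, hg⟩ := frame_eq_frame_iff.1 h3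
    exact ⟨g, hg.symm⟩
  -- The element `g` depends on the point, but it ranges over a finite set, so the ultrafilter
  -- selects a single one.
  obtain ⟨g, hg⟩ : ∃ g : c.1.G, ∀ᶠ p : GLn n × O.FrameBundle in 𝒰,
      frameMulInv p.1 (i₂.localInverse p.2) = g • i₁.localInverse (p.1 • p.2) := by
    have h := (Ultrafilter.finite_biUnion_mem_iff (f := 𝒰) (is := (univ : Set c.1.G))
      (s := fun g => {p : GLn n × O.FrameBundle |
        frameMulInv p.1 (i₂.localInverse p.2) = g • i₁.localInverse (p.1 • p.2)})
      finite_univ).1 (mem_of_superset hex fun p hp => by simpa using hp)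
    obtain ⟨g, -, hg⟩ := h
    exact ⟨g, hg⟩
  have u₁ : Tendsto (fun p : GLn n × O.FrameBundle => (g • i₁.localInverse (p.1 • p.2)).2) 𝒰
      (𝓝 (g • z₁).2) :=
    ((continuous_snd.comp (continuous_const_smul g)).tendsto z₁).comp s₁
  have u₂ : Tendsto (fun p : GLn n × O.FrameBundle => (i₂.localInverse p.2).2) 𝒰 (𝓝 B) :=
    (continuous_snd.tendsto _).comp s₂
  refine ⟨(g • z₁).2⁻¹ * B, (u₁.inv.mul u₂).congr' ?_⟩
  filter_upwards [hg] with p hp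
  have h2 : (i₂.localInverse p.2).2 * p.1⁻¹ = (g • i₁.localInverse (p.1 • p.2)).2 :=
    congrArg Prod.snd hp
  rw [inv_mul_eq_iff_eq_mul, ← h2, inv_mul_cancel_right]

end AnalyticOrbifold

end Topology

/-! ### Charts of the maximal atlas -/

section MaximalAtlas

variable {n : ℕ} {X : Type*} [TopologicalSpace X]

theorem nonempty_chartEmbedding_refl (c : OrbifoldChart n X) [FaithfulSMul c.G c.dom] :
    Nonempty (ChartEmbedding c c) :=
  let ⟨e, _⟩ := exists_chartEmbedding (c := c) (d := c) (F := id)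
    (fun _ hx => .id c hx) (injOn_id _)
  ⟨e⟩

/-- Two reduced charts related by a transition map at a point are linked by linear charts around
this point. -/
theorem IsTransition.exists_linear_chartEmbedding {c d : OrbifoldChart n X}
    [FaithfulSMul c.G c.dom] [FaithfulSMul d.G d.dom] {f : Euc n → Euc n} {u : c.dom}
    (hf : IsTransition c d f u) :
    ∃ e : OrbifoldChart n X, e.IsLinear ∧ FaithfulSMul e.G e.dom ∧ c.proj u ∈ range e.proj ∧
      Nonempty (ChartEmbedding e c) ∧ Nonempty (ChartEmbedding e d) := by
  obtain ⟨P, hP, hPf, -⟩ := hf.exists_openPartialHomeomorph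
  -- The linear chart is taken so small that `f` is a transition map and injective on it; then both
  -- `F` and `f ∘ F` define embeddings.
  obtain ⟨e, he, hef, F, hF, hinj, hF0⟩ := c.exists_linear u
    (inter_mem hf.eventually (P.open_source.mem_nhds hP))
  obtain ⟨a, -⟩ := exists_chartEmbedding (c := e) (d := c) (fun v _ => (hF v).1) hinj.injOn
  obtain ⟨b, -⟩ := exists_chartEmbedding (c := e) (d := d) (F := f ∘ F)
    (fun v _ => IsTransition.comp (hF v).2.1 (hF v).1) (by
      intro v _ w _ hvw
      refine hinj (P.injOn (hF v).2.2 (hF w).2.2 ?_)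
      rw [hPf]
      exact hvw)
  refine ⟨e, he, hef, ⟨e.toDom 0, ?_⟩, ⟨a⟩, ⟨b⟩⟩
  rw [← (hF 0).1.proj_eq, hF0, c.toDom_coe]

/-- A reduced chart which is locally related to the charts of a reduced orbifold by transition maps
belongs to its maximal atlas. -/
theorem AnalyticOrbifold.mem_atlas_of_isTransition {O : AnalyticOrbifold n X} (hO : O.IsReduced)
    {c : OrbifoldChart n X} (hc : FaithfulSMul c.G c.dom)
    (h : ∀ u : c.dom, ∃ d ∈ O.atlas, ∃ f, IsTransition c d f u) : c ∈ O.atlas := by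
  -- All such charts form an atlas containing `O.atlas`. It is equivalent to `O.atlas`, with
  -- `O.atlas` itself as common refinement, so maximality applies.
  let A : Set (OrbifoldChart n X) :=
    {c | FaithfulSMul c.G c.dom ∧ ∀ u : c.dom, ∃ d ∈ O.atlas, ∃ f, IsTransition c d f u}
  have hOA : O.atlas ⊆ A := fun d hd => ⟨hO d hd, fun u => ⟨d, hd, id, .id d u.2⟩⟩
  have hA : IsOrbifoldAtlas A := by
    refine ⟨fun x => ?_, ?_⟩
    · obtain ⟨d, hd, hx⟩ := O.isAtlas.cover x
      exact ⟨d, hOA hd, hx⟩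
    · rintro c₁ ⟨hc₁, h₁⟩ c₂ ⟨hc₂, h₂⟩ x ⟨⟨u₁, hu₁⟩, ⟨u₂, hu₂⟩⟩
      obtain ⟨d₁, hd₁, f₁, hf₁⟩ := h₁ u₁
      obtain ⟨d₂, hd₂, f₂, hf₂⟩ := h₂ u₂
      -- Charts `c₁` and `c₂` are related through charts of `O`, by `f₁`, then `g`, then a local
      -- inverse of `f₂`.
      obtain ⟨g, hg, hgu⟩ := O.exists_isTransition hd₁ hd₂ hf₁.map_mem hf₂.map_mem (by
        rw [hf₁.proj_eq, hf₂.proj_eq, c₁.toDom_coe, c₂.toDom_coe, hu₁, hu₂])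
      obtain ⟨s, hs, -, -⟩ := hf₂.symm
      rw [← hgu] at hs
      obtain ⟨e, -, hef, hxe, ⟨a⟩, hb⟩ :=
        (IsTransition.comp (f := g ∘ f₁) hs (hg.comp hf₁)).exists_linear_chartEmbedding
      rw [hu₁] at hxe
      refine ⟨e, ⟨hef, fun v => ?_⟩, hxe, ⟨a⟩, hb⟩
      have ha := a.isTransition v.2
      obtain ⟨d, hd, f, hf⟩ := h₁ ⟨_, ha.map_mem⟩
      exact ⟨d, hd, _, hf.comp ha⟩
  refine O.maximal A hA ⟨O.atlas, O.isAtlas, fun d hd => ⟨d, hOA hd, ?_⟩, fun d hd => ⟨d, hd, ?_⟩⟩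
    ⟨hc, h⟩
  all_goals
    have := hO d hd
    exact nonempty_chartEmbedding_refl d

theorem AnalyticOrbifold.mem_atlas_of_chartEmbedding {O : AnalyticOrbifold n X}
    (hO : O.IsReduced) {c d : OrbifoldChart n X} (hd : d ∈ O.atlas) (e : ChartEmbedding c d) :
    c ∈ O.atlas :=
  have := hO d hd
  O.mem_atlas_of_isTransition hO e.faithful fun u => ⟨d, hd, _, e.isTransition u.2⟩

end MaximalAtlas

/-! ### Transport of orbifold structures along homeomorphisms -/

section Transport

variable {n : ℕ} {X Y : Type*} [TopologicalSpace X] [TopologicalSpace Y]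

/-- The orbifold chart obtained by composing the projection with a homeomorphism. -/
def OrbifoldChart.mapHomeo (c : OrbifoldChart n X) (f : X ≃ₜ Y) : OrbifoldChart n Y where
  dom := c.dom
  isConnected_dom := c.isConnected_dom
  G := c.G
  analytic_smul := c.analytic_smul
  proj := fun u => f (c.proj u)
  proj_smul g x := congrArg f (c.proj_smul g x)
  isOpenEmbedding_lift := by
    convert f.isOpenEmbedding.comp c.isOpenEmbedding_lift using 1
    ext q
    induction q using Quotient.inductionOn with | h z => ?_
    rfl

theorem OrbifoldChart.mapHomeo_mapHomeo_symm (c : OrbifoldChart n X) (f : X ≃ₜ Y) :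
    (c.mapHomeo f).mapHomeo f.symm = c := by
  obtain ⟨U, hU, G, hG, p, hp, ho⟩ := c
  simp only [OrbifoldChart.mapHomeo, Homeomorph.symm_apply_apply]

theorem OrbifoldChart.mapHomeo_symm_mapHomeo (c : OrbifoldChart n Y) (f : X ≃ₜ Y) :
    (c.mapHomeo f.symm).mapHomeo f = c :=
  c.mapHomeo_mapHomeo_symm f.symm

theorem OrbifoldChart.mem_range_proj_mapHomeo {c : OrbifoldChart n X} {f : X ≃ₜ Y} {y : Y} :
    y ∈ range (c.mapHomeo f).proj ↔ f.symm y ∈ range c.proj := by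
  constructor
  · rintro ⟨u, rfl⟩
    exact ⟨u, (f.symm_apply_apply _).symm⟩
  · rintro ⟨u, hu⟩
    exact ⟨u, by change f (c.proj u) = y; rw [hu, f.apply_symm_apply]⟩

/-- Transport of an embedding of charts along a homeomorphism. -/
def ChartEmbedding.mapHomeo {c d : OrbifoldChart n X} (e : ChartEmbedding c d) (f : X ≃ₜ Y) :
    ChartEmbedding (c.mapHomeo f) (d.mapHomeo f) where
  hom := e.hom
  hom_injective := e.hom_injective
  map_ker := e.map_ker
  map := e.map
  isEmbedding := e.isEmbedding
  analytic := e.analytic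
  immersive := e.immersive
  equivariant := e.equivariant
  proj_map u := congrArg f (e.proj_map u)

/-- Transport of a family of charts along a homeomorphism. -/
def mapAtlas (f : X ≃ₜ Y) (A : Set (OrbifoldChart n X)) : Set (OrbifoldChart n Y) :=
  {c | c.mapHomeo f.symm ∈ A}

theorem mapHomeo_mem_mapAtlas {f : X ≃ₜ Y} {A : Set (OrbifoldChart n X)} {c : OrbifoldChart n X}
    (hc : c ∈ A) : c.mapHomeo f ∈ mapAtlas f A := by
  rwa [mapAtlas, mem_ofPred_eq, c.mapHomeo_mapHomeo_symm]

theorem mapAtlas_symm_mapAtlas (f : X ≃ₜ Y) (A : Set (OrbifoldChart n X)) :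
    mapAtlas f.symm (mapAtlas f A) = A := by
  ext c
  exact iff_of_eq (congrArg (· ∈ A) (c.mapHomeo_mapHomeo_symm f))

theorem nonempty_chartEmbedding_mapHomeo {f : X ≃ₜ Y} {c : OrbifoldChart n X}
    {d : OrbifoldChart n Y} (h : Nonempty (ChartEmbedding c (d.mapHomeo f.symm))) :
    Nonempty (ChartEmbedding (c.mapHomeo f) d) := by
  obtain ⟨e⟩ := h
  have := e.mapHomeo f
  rw [d.mapHomeo_symm_mapHomeo] at this
  exact ⟨this⟩

theorem IsOrbifoldAtlas.mapAtlas {A : Set (OrbifoldChart n X)} (hA : IsOrbifoldAtlas A)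
    (f : X ≃ₜ Y) : IsOrbifoldAtlas (mapAtlas f A) := by
  refine ⟨fun y => ?_, fun c hc d hd y hy => ?_⟩
  · obtain ⟨c, hc, hy⟩ := hA.cover (f.symm y)
    exact ⟨_, mapHomeo_mem_mapAtlas hc, OrbifoldChart.mem_range_proj_mapHomeo.2 hy⟩
  · obtain ⟨e, he, hye, ha, hb⟩ := hA.compat _ hc _ hd (f.symm y)
      ⟨OrbifoldChart.mem_range_proj_mapHomeo.2 (by simpa using hy.1),
        OrbifoldChart.mem_range_proj_mapHomeo.2 (by simpa using hy.2)⟩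
    exact ⟨_, mapHomeo_mem_mapAtlas he, OrbifoldChart.mem_range_proj_mapHomeo.2 hye,
      nonempty_chartEmbedding_mapHomeo ha, nonempty_chartEmbedding_mapHomeo hb⟩

theorem Refines.mapAtlas {A B : Set (OrbifoldChart n X)} (h : Refines A B) (f : X ≃ₜ Y) :
    Refines (mapAtlas f A) (mapAtlas f B) := by
  intro c hc
  obtain ⟨d, hd, ⟨e⟩⟩ := h _ hc
  have := e.mapHomeo f
  rw [c.mapHomeo_symm_mapHomeo] at this
  exact ⟨_, mapHomeo_mem_mapAtlas hd, ⟨this⟩⟩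

/-- Transport of an orbifold structure along a homeomorphism. -/
def AnalyticOrbifold.mapHomeo (O : AnalyticOrbifold n X) (f : X ≃ₜ Y) : AnalyticOrbifold n Y where
  t2Space := have := O.t2Space; f.symm.isEmbedding.t2Space
  paracompactSpace := have := O.paracompactSpace; f.symm.isClosedEmbedding.paracompactSpace
  atlas := mapAtlas f O.atlas
  isAtlas := O.isAtlas.mapAtlas f
  maximal := by
    rintro A hA ⟨C, hC, hCA, hCO⟩ c hc
    refine O.maximal (mapAtlas f.symm A) (hA.mapAtlas f.symm)
      ⟨mapAtlas f.symm C, hC.mapAtlas _, hCA.mapAtlas _, ?_⟩ (mapHomeo_mem_mapAtlas hc)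
    have := hCO.mapAtlas f.symm
    rwa [mapAtlas_symm_mapAtlas] at this

theorem AnalyticOrbifold.IsReduced.mapHomeo {O : AnalyticOrbifold n X} (hO : O.IsReduced)
    (f : X ≃ₜ Y) : (O.mapHomeo f).IsReduced := fun _ hc => hO _ hc

/-- A chart and its transport have the same domain and group, so the identity is a lift in both
directions. -/
theorem AnalyticOrbifold.isAnalyticOrbifoldDiffeo_mapHomeo (O : AnalyticOrbifold n X)
    (f : X ≃ₜ Y) : IsAnalyticOrbifoldDiffeo (O.mapHomeo f) O f.symm.toEquiv := by
  refine ⟨fun y => ?_, fun x => ?_⟩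
  · obtain ⟨c, hc, hx⟩ := O.isAtlas.cover (f.symm y)
    refine ⟨c.mapHomeo f, mapHomeo_mem_mapAtlas hc, c, hc,
      OrbifoldChart.mem_range_proj_mapHomeo.2 hx, hx, ?_, fun u => u, MonoidHom.id _,
      contMDiff_id, fun _ _ => rfl, fun u => (f.symm_apply_apply _).symm⟩
    rintro _ ⟨u, rfl⟩
    exact ⟨u, (f.symm_apply_apply _).symm⟩
  · obtain ⟨c, hc, hx⟩ := O.isAtlas.cover x
    refine ⟨c, hc, c.mapHomeo f, mapHomeo_mem_mapAtlas hc, hx,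
      OrbifoldChart.mem_range_proj_mapHomeo.2 (by simpa using hx), ?_, fun u => u,
      MonoidHom.id _, contMDiff_id, fun _ _ => rfl, fun u => rfl⟩
    rintro _ ⟨u, rfl⟩
    exact ⟨u, rfl⟩

end Transport

/-! ### The orbit space of the frame bundle -/

section OrbitSpace

variable {n : ℕ} {X : Type*} [TopologicalSpace X]

namespace AnalyticOrbifold

theorem isOpenMap_frameBundleProj (O : AnalyticOrbifold n X) :
    IsOpenMap (O.frameBundleProj : O.FrameBundle → X) := by
  intro W hW
  have h : O.frameBundleProj '' W =
      ⋃ c : O.atlas, (c.1.proj ∘ Prod.fst) '' (O.frame c ⁻¹' W) := by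
    ext x
    rw [mem_iUnion]
    constructor
    · rintro ⟨y, hy, rfl⟩
      obtain ⟨c, z, rfl⟩ := exists_frame_eq y
      exact ⟨c, z, hy, rfl⟩
    · rintro ⟨c, z, hz, rfl⟩
      exact ⟨_, hz, rfl⟩
  rw [h]
  exact isOpen_iUnion fun c => (c.1.isOpenMap_proj.comp isOpenMap_fst) _
    (hW.preimage (continuous_frame c))

/-- Points of one fibre are represented by frames at the same chart point, and `GL_n(ℝ)` is
transitive on these. -/
theorem frameBundleProj_eq_iff {O : AnalyticOrbifold n X} {y y' : O.FrameBundle} :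
    O.frameBundleProj y = O.frameBundleProj y' ↔ ∃ A : GLn n, A • y' = y := by
  constructor
  · intro h
    obtain ⟨c, z, rfl⟩ := exists_frame_eq y'
    obtain ⟨B, rfl⟩ := exists_frame_eq_of_proj_eq c z.1 h
    refine ⟨B⁻¹ * z.2, ?_⟩
    rw [smul_frame, frameMulInv, mul_inv_rev, inv_inv, mul_inv_cancel_left]
  · rintro ⟨A, rfl⟩
    exact frameBundleProj_smul A y'

/-- The homeomorphism from the orbit space of the frame bundle to the orbifold. -/
noncomputable def orbitHomeo (O : AnalyticOrbifold n X) :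
    MulAction.orbitRel.Quotient (GLn n) O.FrameBundle ≃ₜ X :=
  Equiv.toHomeomorphOfContinuousOpen
    (Equiv.ofBijective (Quotient.lift O.frameBundleProj (by
        rintro _ y ⟨A, rfl⟩
        exact frameBundleProj_smul A y)) (by
      constructor
      · intro a b
        induction a using Quotient.inductionOn with | h a => ?_
        induction b using Quotient.inductionOn with | h b => ?_
        intro h
        exact Quotient.sound (s := MulAction.orbitRel (GLn n) O.FrameBundle)
          (frameBundleProj_eq_iff.1 h)
      · intro x
        obtain ⟨c, w, rfl⟩ := exists_mem_range_proj (O := O) x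
        exact ⟨Quotient.mk _ (O.frame c (w, 1)), rfl⟩))
    (continuous_frameBundleProj.quotient_lift _) (by
      intro W hW
      convert O.isOpenMap_frameBundleProj _ (hW.preimage
        (continuous_quotient_mk' (s := MulAction.orbitRel (GLn n) O.FrameBundle))) using 1
      ext x
      constructor
      · rintro ⟨a, ha, rfl⟩
        induction a using Quotient.inductionOn with | h a => ?_
        exact ⟨a, ha, rfl⟩
      · rintro ⟨a, ha, rfl⟩
        exact ⟨_, ha, rfl⟩)

theorem orbitHomeo_mk (O : AnalyticOrbifold n X) (y : O.FrameBundle) :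
    O.orbitHomeo (Quotient.mk (MulAction.orbitRel (GLn n) O.FrameBundle) y) =
      O.frameBundleProj y := rfl

end AnalyticOrbifold

end OrbitSpace

/-! ### Linear charts and linear slices -/

section Slices

variable {n : ℕ} {X : Type*} [TopologicalSpace X]

/-- The linear representation underlying a linear chart. -/
theorem OrbifoldChart.IsLinear.exists_hom {e : OrbifoldChart n X} (he : e.IsLinear) :
    ∃ γ : e.G →* GLn n, (∀ g (u : e.dom), ((g • u : e.dom) : Euc n) = (γ g : EndEuc n) u) ∧
      ∀ g (z : Frame e.dom), g • z = (g • z.1, γ g * z.2) := by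
  choose L hL using he.2
  have hjac : ∀ g (u : e.dom), jac (fun x : e.dom => g • x) u = L g := by
    intro g u
    have h : e.ext (fun x : e.dom => g • x) =ᶠ[𝓝 (u : Euc n)] L g := by
      filter_upwards [e.isOpen_dom.mem_nhds u.2] with y hy
      rw [OrbifoldChart.ext, hL, e.coe_toDom hy]
    rw [e.jac_eq_fderiv (e.analytic_smul g), h.fderiv_eq, ContinuousLinearMap.fderiv]
  obtain ⟨o, ho⟩ := e.isConnected_dom.nonempty
  have hu : ∀ g, IsUnit (L g) := fun g => hjac g ⟨o, ho⟩ ▸ e.isUnit_jac_smul g ⟨o, ho⟩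
  have hsmul : ∀ g (z : Frame e.dom), g • z = (g • z.1, (hu g).unit * z.2) := fun g z =>
    Prod.ext rfl (Units.ext (congrArg (· * (z.2 : EndEuc n)) (hjac g z.1)))
  -- Multiplicativity is read off from the action on the frame `(o, 1)`.
  refine ⟨{ toFun := fun g => (hu g).unit, map_one' := ?_, map_mul' := fun g h => ?_ },
    fun g u => hL g u, hsmul⟩
  · have h := congrArg Prod.snd (hsmul 1 (⟨o, ho⟩, 1))
    rw [one_smul, mul_one] at h
    exact h.symm
  · have hgh := congrArg Prod.snd (hsmul (g * h) (⟨o, ho⟩, 1))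
    rw [mul_smul, hsmul h, hsmul g, mul_one, mul_one] at hgh
    exact hgh.symm

/-- The diffeomorphism `(A, u) ↦ (u, A⁻¹)`. -/
noncomputable def invSwap (U : Opens (Euc n)) :
    Diffeomorph ((modelGL n).prod (modelEuc n)) (modelFrame n) (GLn n × U) (Frame U) ω where
  toFun p := (p.2, p.1⁻¹)
  invFun z := (z.2⁻¹, z.1)
  left_inv p := by simp
  right_inv z := by simp
  contMDiff_toFun := contMDiff_snd.prodMk contMDiff_fst.inv
  contMDiff_invFun := contMDiff_snd.inv.prodMk contMDiff_fst

namespace AnalyticOrbifold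

variable {O : AnalyticOrbifold n X} [ChartedSpace (FrameModelSpace n) O.FrameBundle]

/-- The slice at `[0, 1]` is the constant frame `u ↦ [u, 1]`. As `g` acts on frames by `(u, B) ↦ (g
u, γ(g) B)`, the isotropy group of `[0, 1]` is `γ(G)`. Since `A • [u, 1] = [u, A⁻¹]`, the orbit map
is `Fr(Ũ) → Fr(X)` up to the diffeomorphism `invSwap`, and the slice condition is the description of
equality of frames in one chart. -/
theorem isLinearSliceChart_of_isLinear (hO : O.IsReduced)
    (hψ : ∀ c : O.atlas, IsLocalDiffeomorph (modelFrame n) (modelFrame n) ω (O.frame c))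
    {e : OrbifoldChart n X} (heO : e ∈ O.atlas) (he : e.IsLinear) :
    IsLinearSliceChart (modelGL n) (modelFrame n) (e.mapHomeo O.orbitHomeo.symm) := by
  have := hO e heO
  obtain ⟨γ, hγ, hsmul⟩ := he.exists_hom
  let c : O.atlas := ⟨e, heO⟩
  let o : e.dom := ⟨0, by rw [he.1]; trivial⟩
  have ho : ∀ g : e.G, g • o = o := fun g => Subtype.ext ((hγ g o).trans (map_zero _))
  have heq : ∀ (A B : GLn n) (u v : e.dom), O.frame c (u, A) = O.frame c (v, B) ↔
      ∃ g : e.G, g • u = v ∧ γ g * A = B := by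
    intro A B u v
    refine frame_eq_frame_iff.trans (exists_congr fun g => ?_)
    rw [hsmul, Prod.mk.injEq]
  have hsm : ∀ (A : GLn n) (u : e.dom), A • O.frame c (u, 1) = O.frame c (u, A⁻¹) :=
    fun A u => by rw [smul_frame, frameMulInv, one_mul]
  have hmem : ∀ g, γ g ∈ MulAction.stabilizer (GLn n) (O.frame c (o, 1)) := fun g => by
    rw [MulAction.mem_stabilizer_iff, hsm, heq]
    exact ⟨g, ho g, mul_inv_cancel _⟩
  have hbij : Function.Bijective (γ.codRestrict _ hmem) := by
    constructor
    · rw [injective_iff_map_eq_one]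
      intro g hg
      refine (e.frame_smul_eq_self_iff (z := (o, 1))).1 ?_
      rw [hsmul, ho, show γ g = 1 from congrArg Subtype.val hg, one_mul]
    · rintro ⟨A, hA⟩
      rw [MulAction.mem_stabilizer_iff, hsm, heq] at hA
      obtain ⟨g, -, hg⟩ := hA
      exact ⟨g, Subtype.ext (mul_inv_eq_one.1 hg)⟩
  have hequiv : ∀ (g : e.G) (u : e.dom), O.frame c (g • u, 1) = γ g • O.frame c (u, 1) := by
    intro g u
    rw [hsm, eq_comm, heq]
    exact ⟨g, rfl, mul_inv_cancel _⟩
  have hdiffeo : IsLocalDiffeomorph ((modelGL n).prod (modelEuc n)) (modelFrame n) ω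
      (fun p : GLn n × e.dom => p.1 • O.frame c (p.2, 1)) := by
    have h : (fun p : GLn n × e.dom => p.1 • O.frame c (p.2, 1)) =
        O.frame c ∘ invSwap e.dom := funext fun p => hsm p.1 p.2
    rw [h]
    exact fun p => ((invSwap e.dom).isLocalDiffeomorph p).comp (modelFrame n) O.FrameBundle (hψ c _)
  have hslice : ∀ (a b : GLn n) (u v : e.dom),
      a • O.frame c (u, 1) = b • O.frame c (v, 1) → ∃ g : e.G, b = a * (γ g)⁻¹ ∧ v = g • u := by
    intro a b u v h
    rw [hsm, hsm, heq] at h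
    obtain ⟨g, hgu, hg⟩ := h
    refine ⟨g, ?_, hgu.symm⟩
    rw [← inv_inj, ← hg, mul_inv_rev, inv_inv]
  refine ⟨he.1, he.2, o, fun u => O.frame c (u, 1), MulEquiv.ofBijective _ hbij, rfl, ?_, hequiv,
    ?_, hdiffeo, hslice⟩
  · exact (hψ c).contMDiff.comp (contMDiff_id.prodMk contMDiff_const)
  · intro u
    refine O.orbitHomeo.injective ?_
    change O.orbitHomeo (O.orbitHomeo.symm (e.proj u)) = _
    rw [Homeomorph.apply_symm_apply]
    rfl

/-- Lifting a slice to the frames on a chart gives transition maps. -/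
theorem exists_isTransition_of_slice
    (hψ : ∀ c : O.atlas, IsLocalDiffeomorph (modelFrame n) (modelFrame n) ω (O.frame c))
    {c : OrbifoldChart n X} {s : c.dom → O.FrameBundle}
    (hs : ContMDiff (modelEuc n) (modelFrame n) ω s)
    (hp : ∀ u, O.frameBundleProj (s u) = c.proj u)
    (hl : IsLocalDiffeomorph ((modelGL n).prod (modelEuc n)) (modelFrame n) ω
      (fun p : GLn n × c.dom => p.1 • s p.2)) (u : c.dom) :
    ∃ (d : O.atlas) (f : Euc n → Euc n), IsTransition c d.1 f u ∧
      ∀ᶠ w : c.dom in 𝓝 u, ∃ z : Frame d.1.dom, (z.1 : Euc n) = f w ∧ O.frame d z = s w := by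
  obtain ⟨d, z, hz⟩ := exists_frame_eq (s u)
  -- `σ` is a local inverse of `Fr(Ũ) → Fr(X)`, giving frame coordinates near `s u`; `κ` below is a
  -- local inverse of `(A, w) ↦ A • s w`, giving slice coordinates.
  obtain ⟨σ, hσ, hσu, hσr, hσl⟩ : ∃ σ : O.FrameBundle → Frame d.1.dom,
      ContMDiffAt (modelFrame n) (modelFrame n) ω σ (s u) ∧ σ (s u) = z ∧
      (∀ᶠ y in 𝓝 (s u), O.frame d (σ y) = y) ∧ ∀ᶠ v in 𝓝 z, σ (O.frame d v) = v := by
    have i := hψ d z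
    rw [← hz]
    exact ⟨i.localInverse, i.localInverse_contMDiffAt,
      i.localInverse_left_inv i.localInverse_mem_target, i.localInverse_eventuallyEq_right,
      i.localInverse_eventuallyEq_left⟩
  obtain ⟨κ, hκ, hκu, hκr⟩ : ∃ κ : O.FrameBundle → GLn n × c.dom,
      ContMDiffAt (modelFrame n) ((modelGL n).prod (modelEuc n)) ω κ (s u) ∧ κ (s u) = (1, u) ∧
      ∀ᶠ y in 𝓝 (s u), (κ y).1 • s (κ y).2 = y := by
    have j := hl (1, u)
    have h1 : s u = (1 : GLn n) • s u := (one_smul _ _).symm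
    rw [h1]
    exact ⟨j.localInverse, j.localInverse_contMDiffAt,
      j.localInverse_left_inv j.localInverse_mem_target, j.localInverse_eventuallyEq_right⟩
  have hσs : ContMDiffAt (modelEuc n) (modelFrame n) ω (fun w : c.dom => σ (s w)) u :=
    hσ.comp u (hs u)
  let f : Euc n → Euc n := fun y => (σ (s (c.toDom y))).1
  have hfw : ∀ w : c.dom, f w = (σ (s w)).1 := fun w => by simp only [f, c.toDom_coe]
  have hfu : f u = z.1 := by rw [hfw, hσu]
  have hcd : ContMDiffAt (modelEuc n) (modelEuc n) ω c.toDom (u : Euc n) :=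
    c.contMDiffAt_toDom u.2
  have hf : ContDiffAt ℝ ω f u := by
    rw [← contMDiffAt_iff_contDiffAt]
    have h1 : ContMDiffAt (modelEuc n) (modelFrame n) ω (fun y => σ (s (c.toDom y))) (u : Euc n) :=
      ContMDiffAt.comp (g := fun w : c.dom => σ (s w)) (u : Euc n) (by rwa [c.toDom_coe]) hcd
    exact (contMDiff_subtype_val _).comp _ (contMDiffAt_fst.comp _ h1)
  -- A local right inverse of `f`: give `y` the constant frame `z.2` and take its slice coordinate.
  -- The discarded group coordinate does not move the base point.
  let R : Euc n → Euc n := fun y => (κ (O.frame d (d.1.toDom y, z.2))).2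
  have hz' : O.frame d (d.1.toDom z.1, z.2) = s u := by rw [d.1.toDom_coe, hz]
  have hι : ContMDiffAt (modelEuc n) (modelFrame n) ω
      (fun y => ((d.1.toDom y, z.2) : Frame d.1.dom)) (z.1 : Euc n) :=
    (d.1.contMDiffAt_toDom z.1.2).prodMk contMDiffAt_const
  have hι' : ContMDiffAt (modelEuc n) (modelFrame n) ω
      (fun y => O.frame d (d.1.toDom y, z.2)) (z.1 : Euc n) :=
    ((hψ d).contMDiff _).comp _ hι
  have hκι : ContMDiffAt (modelEuc n) ((modelGL n).prod (modelEuc n)) ω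
      (fun y => κ (O.frame d (d.1.toDom y, z.2))) (z.1 : Euc n) :=
    ContMDiffAt.comp (z.1 : Euc n) (by rwa [hz']) hι'
  have hR : ContDiffAt ℝ ω R z.1 := by
    rw [← contMDiffAt_iff_contDiffAt]
    exact (contMDiff_subtype_val _).comp _ (contMDiffAt_snd.comp _ hκι)
  have hRz : R z.1 = u := by simp only [R, hz', hκu]
  have hfR : f ∘ R =ᶠ[𝓝 (z.1 : Euc n)] id := by
    have t1 : Tendsto (fun y => O.frame d (d.1.toDom y, z.2)) (𝓝 (z.1 : Euc n)) (𝓝 (s u)) := by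
      have := hι'.continuousAt.tendsto
      rwa [hz'] at this
    have t2 : Tendsto (fun y => κ (O.frame d (d.1.toDom y, z.2))) (𝓝 (z.1 : Euc n))
        (𝓝 (1, u)) := by
      have := hκι.continuousAt.tendsto
      rwa [hz', hκu] at this
    have t3 : Tendsto (fun y => s (κ (O.frame d (d.1.toDom y, z.2))).2) (𝓝 (z.1 : Euc n))
        (𝓝 (s u)) := (hs.continuous.tendsto u).comp ((continuous_snd.tendsto _).comp t2)
    have t4 : Tendsto (fun y => σ (s (κ (O.frame d (d.1.toDom y, z.2))).2)) (𝓝 (z.1 : Euc n))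
        (𝓝 z) := by
      have := hσ.continuousAt.tendsto
      rw [hσu] at this
      exact this.comp t3
    -- Together with the other limits, this keeps all frames where `σ` inverts the chart map, so
    -- that `σ` commutes with the group factor of `κ` near `z.1`.
    have t5 : Tendsto (fun y => frameMulInv (κ (O.frame d (d.1.toDom y, z.2))).1
        (σ (s (κ (O.frame d (d.1.toDom y, z.2))).2))) (𝓝 (z.1 : Euc n)) (𝓝 z) := by
      have h1 := ((contMDiff_frameMulInv d.1.dom).continuous.tendsto (1, z)).comp
        (((continuous_fst.tendsto _).comp t2).prodMk_nhds t4)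
      have h2 : frameMulInv (1 : GLn n) z = z := by
        rw [frameMulInv, inv_one, mul_one]
      simp only [h2] at h1
      exact h1
    have t6 : Tendsto (fun y => ((d.1.toDom y, z.2) : Frame d.1.dom)) (𝓝 (z.1 : Euc n))
        (𝓝 z) := by
      have := hι.continuousAt.tendsto
      rwa [d.1.toDom_coe] at this
    filter_upwards [t1.eventually hκr, t3.eventually hσr, t5.eventually hσl, t6.eventually hσl,
      d.1.isOpen_dom.mem_nhds z.1.2] with y h1 h2 h3 h4 hyd
    rw [← smul_frame, h2, h1, h4] at h3
    have h5 := congrArg (fun v : Frame d.1.dom => (v.1 : Euc n)) h3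
    change (d.1.toDom y : Euc n) = (σ (s (κ (O.frame d (d.1.toDom y, z.2))).2)).1 at h5
    rw [d.1.coe_toDom hyd] at h5
    rw [Function.comp_apply, id, hfw, ← h5]
  have hunit : IsUnit (fderiv ℝ f u) := by
    have h1 := _root_.fderiv_comp (z.1 : Euc n) (f := R) (g := f)
      (by rw [hRz]; exact hf.differentiableAt (by simp)) (hR.differentiableAt (by simp))
    rw [hfR.fderiv_eq, fderiv_id, hRz] at h1
    -- The right inverse `R` makes the derivative of `f` surjective, hence invertible in finite
    -- dimension.
    have hsurj : Function.Surjective (fderiv ℝ f u) := fun v =>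
      ⟨fderiv ℝ R z.1 v, (DFunLike.congr_fun h1 v).symm⟩
    exact ContinuousLinearMap.isUnit_iff_bijective.2
      ⟨(LinearMap.injective_iff_surjective (f := (fderiv ℝ f u).toLinearMap)).2 hsurj, hsurj⟩
  have hev : ∀ᶠ w : c.dom in 𝓝 u, O.frame d (σ (s w)) = s w :=
    (hs.continuous.tendsto u).eventually hσr
  refine ⟨d, f, ⟨hf, hunit, ?_⟩, hev.mono fun w hw => ⟨σ (s w), (hfw w).symm, hw⟩⟩
  have hev' : ∀ᶠ y in 𝓝 (u : Euc n), O.frame d (σ (s (c.toDom y))) = s (c.toDom y) :=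
    hcd.continuousAt.eventually (by rwa [c.toDom_coe])
  filter_upwards [hev', c.isOpen_dom.mem_nhds u.2] with y hy hyc
  refine ⟨hyc, (σ (s (c.toDom y))).1.2, ?_⟩
  rw [d.1.toDom_coe, ← frameBundleProj_frame, hy, hp]

/-- Local lifts of the slice give transition maps to charts of `O`, so only faithfulness of the
slice representation has to be checked; it is inherited from effectiveness of the charts of `O`. -/
theorem mem_atlas_of_isLinearSliceChart (hO : O.IsReduced)
    (hψ : ∀ c : O.atlas, IsLocalDiffeomorph (modelFrame n) (modelFrame n) ω (O.frame c))
    {c : OrbifoldChart n (MulAction.orbitRel.Quotient (GLn n) O.FrameBundle)}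
    (hc : IsLinearSliceChart (modelGL n) (modelFrame n) c) :
    c.mapHomeo O.orbitHomeo ∈ O.atlas := by
  obtain ⟨-, -, o, s, ι, -, hs, hι, hcs, hl, -⟩ := hc
  have hp : ∀ u : c.dom, O.frameBundleProj (s u) = (c.mapHomeo O.orbitHomeo).proj u := by
    intro u
    change _ = O.orbitHomeo (c.proj u)
    rw [hcs, orbitHomeo_mk]
  have htr := exists_isTransition_of_slice (c := c.mapHomeo O.orbitHomeo) hψ hs hp hl
  refine O.mem_atlas_of_isTransition hO ⟨fun {g h} hgh => ?_⟩ fun u => ?_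
  · obtain ⟨d, f, hf, hfs⟩ := htr o
    have := hO d.1 d.2
    have hev : ∀ᶠ y in 𝓝 (o : Euc n), ∃ w : c.dom, ∃ z : Frame d.1.dom,
        (z.1 : Euc n) = f y ∧ O.frame d z = s w := by
      have h1 := ((c.mapHomeo O.orbitHomeo).continuousAt_toDom hf.mem).eventually
        (by rwa [(c.mapHomeo O.orbitHomeo).toDom_coe o])
      filter_upwards [h1, c.isOpen_dom.mem_nhds o.2] with y hy hyc
      obtain ⟨z, hz1, hz2⟩ := hy
      exact ⟨_, z, hz1.trans (congrArg f (OrbifoldChart.coe_toDom _ hyc)), hz2⟩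
    have himg : ∀ᶠ v in 𝓝 (f o), ∃ w : c.dom, ∃ z : Frame d.1.dom,
        (z.1 : Euc n) = v ∧ O.frame d z = s w := by
      rw [← hf.map_nhds_eq]
      exact hev
    -- Transition maps are open, so the image of the slice contains a point `v` with trivial
    -- isotropy in `d`. If `g` and `h` act equally, then `ι g` and `ι h` agree on a frame at `v`,
    -- and the chart element relating the two results fixes `v`; hence it is trivial and `ι g = ι
    -- h`.
    obtain ⟨U, hU, hUo, hoU⟩ := eventually_nhds_iff.1 himg
    obtain ⟨v, hv, hfree⟩ := d.1.exists_forall_smul_eq_imp (hUo.preimage continuous_subtype_val)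
      ⟨⟨f o, hf.map_mem⟩, hoU⟩
    obtain ⟨w, z, hz1, hz2⟩ := hU v hv
    have h1 : (ι g : GLn n) • s w = (ι h : GLn n) • s w :=
      (hι g w).symm.trans ((congrArg s (hgh w)).trans (hι h w))
    rw [← hz2, smul_frame, smul_frame] at h1
    obtain ⟨k, hk⟩ := frame_eq_frame_iff.1 h1
    have hzv : z.1 = v := Subtype.ext hz1
    have hk1 := hfree k (hzv ▸ congrArg Prod.fst hk)
    rw [hk1, one_smul] at hk
    have h2 : z.2 * (ι g : GLn n)⁻¹ = z.2 * (ι h : GLn n)⁻¹ := congrArg Prod.snd hk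
    rw [mul_right_inj, inv_inj] at h2
    exact ι.injective (Subtype.ext h2)
  · obtain ⟨d, f, hf, -⟩ := htr u
    exact ⟨d.1, d.2, f, hf⟩

/-- Slice charts, viewed on `X`, belong to the maximal atlas of `O`. Hence two of them over a common
point are related by a transition map and share a small linear chart, which is again a slice chart.
-/
theorem isQuotientOrbifold_mapHomeo (hO : O.IsReduced)
    (hψ : ∀ c : O.atlas, IsLocalDiffeomorph (modelFrame n) (modelFrame n) ω (O.frame c)) :
    IsQuotientOrbifold (modelGL n) (modelFrame n) (O.mapHomeo O.orbitHomeo.symm) := by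
  refine ⟨⟨fun y => ?_, fun c₁ hc₁ c₂ hc₂ y hy => ?_⟩,
    fun c hc => mem_atlas_of_isLinearSliceChart hO hψ hc⟩
  · obtain ⟨c, w, hw⟩ := exists_mem_range_proj (O := O) (O.orbitHomeo y)
    have := hO c.1 c.2
    obtain ⟨e, he, -, hwe, ⟨a⟩, -⟩ := (IsTransition.id c.1 w.2).exists_linear_chartEmbedding
    refine ⟨_, isLinearSliceChart_of_isLinear hO hψ (O.mem_atlas_of_chartEmbedding hO c.2 a) he, ?_⟩
    rw [OrbifoldChart.mem_range_proj_mapHomeo]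
    exact hw ▸ hwe
  · have h₁ := mem_atlas_of_isLinearSliceChart hO hψ hc₁
    have h₂ := mem_atlas_of_isLinearSliceChart hO hψ hc₂
    have := hO _ h₁
    have := hO _ h₂
    obtain ⟨u₁, hu₁⟩ := hy.1
    obtain ⟨u₂, hu₂⟩ := hy.2
    have hp₁ : (c₁.mapHomeo O.orbitHomeo).proj u₁ = O.orbitHomeo y := congrArg _ hu₁
    have hp₂ : (c₂.mapHomeo O.orbitHomeo).proj u₂ = O.orbitHomeo y := congrArg _ hu₂
    obtain ⟨f, hf, -⟩ := O.exists_isTransition h₁ h₂ (x := u₁) (y := u₂) u₁.2 u₂.2 (by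
      rw [(c₁.mapHomeo O.orbitHomeo).toDom_coe u₁, (c₂.mapHomeo O.orbitHomeo).toDom_coe u₂,
        hp₁, hp₂])
    obtain ⟨e, he, -, hue, ⟨a⟩, ⟨b⟩⟩ := hf.exists_linear_chartEmbedding
    rw [hp₁] at hue
    refine ⟨_, isLinearSliceChart_of_isLinear hO hψ (O.mem_atlas_of_chartEmbedding hO h₁ a) he,
      OrbifoldChart.mem_range_proj_mapHomeo.2 hue, nonempty_chartEmbedding_mapHomeo ⟨a⟩,
      nonempty_chartEmbedding_mapHomeo ⟨b⟩⟩

end AnalyticOrbifold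

end Slices

end FrameOrbifold

theorem theorem3p1 {n : ℕ} {X : Type*} [TopologicalSpace X] [Nonempty X]
    (O : AnalyticOrbifold n X) (hO : O.IsReduced) :
    ∃ _ : ChartedSpace (FrameModelSpace n) O.FrameBundle,
      -- the frame bundle is a real analytic manifold, glued from the `Fr(Ũ_i) / G_i`
      IsManifold (modelFrame n) ω O.FrameBundle ∧
      T2Space O.FrameBundle ∧
      ParacompactSpace O.FrameBundle ∧
      (∀ c : O.atlas, Topology.IsOpenEmbedding (O.ofChart c)) ∧
      (∀ c : O.atlas, IsLocalDiffeomorph (modelFrame n) (modelFrame n) ω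
        (fun z : Frame c.1.dom => O.ofChart c (c.1.frameClass z))) ∧
      -- the action of the general linear group
      ProperSMul (GLn n) O.FrameBundle ∧
      FaithfulSMul (GLn n) O.FrameBundle ∧
      (∀ z : O.FrameBundle, Finite (MulAction.stabilizer (GLn n) z)) ∧
      ContMDiff ((modelGL n).prod (modelFrame n)) (modelFrame n) ω
        (fun p : GLn n × O.FrameBundle => p.1 • p.2) ∧
      -- the quotient orbifold
      ∃ Q : AnalyticOrbifold n (MulAction.orbitRel.Quotient (GLn n) O.FrameBundle),
        IsQuotientOrbifold (modelGL n) (modelFrame n) Q ∧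
        Q.IsReduced ∧
        ∃ f : MulAction.orbitRel.Quotient (GLn n) O.FrameBundle ≃ X,
          IsAnalyticOrbifoldDiffeo Q O f ∧
          ∀ z : O.FrameBundle,
            f (Quotient.mk (MulAction.orbitRel (GLn n) O.FrameBundle) z) =
              O.frameBundleProj z := by
  obtain ⟨hcs, hman, hψ⟩ := AnalyticOrbifold.exists_chartedSpace_frameBundle hO
  exact ⟨hcs, hman, AnalyticOrbifold.t2Space_frameBundle,
    AnalyticOrbifold.paracompactSpace_frameBundle, AnalyticOrbifold.isOpenEmbedding_ofChart, hψ,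
    AnalyticOrbifold.properSMul_frameBundle hψ, AnalyticOrbifold.faithfulSMul_frameBundle hO,
    AnalyticOrbifold.finite_stabilizer, AnalyticOrbifold.contMDiff_smul_frameBundle hψ,
    O.mapHomeo O.orbitHomeo.symm, AnalyticOrbifold.isQuotientOrbifold_mapHomeo hO hψ,
    hO.mapHomeo _, O.orbitHomeo.toEquiv,
    O.isAnalyticOrbifoldDiffeo_mapHomeo O.orbitHomeo.symm, fun z => rfl⟩
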